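/- **Setting.** Let $\mathcal X\subset\mathbb R^d$ and $\mathcal Y\subset\mathbb R$ be bounded (measurable) sets, and let $p_j(x,y)$ (the $j$-th source) and $p_T(x,y)$ (the target) be joint probability densities on $\mathcal X\times\mathcal Y$ with feature marginals $p_j(x),p_T(x)$. Assume covariate shift: $p_T(x)>0\Rightarrow p_j(x)>0$, and $p_T(y\mid x)=p_j(y\mid x)$ wherever $p_T(x)>0$. Assume that the density ratio $r_j(x)=p_T(x)/p_j(x)$ is bounded by a constant $C$. Let $L:\mathcal Y\times\mathcal Y\to[0,\infty)$ be Lipschitz, let the parameter space $\Omega$ be a compact metric space, fix a hyperparameter $\theta$, and let $h(\cdot\,;\omega,\theta):\mathcal X\to\mathcal Y$ be a parametric model, measurable in $x$ and continuous in $\omega\in\Omega$. Assume that the source risk $\omega\mapsto\mathbb E_{p_j}[L(h(x;\omega,\theta),y)]$ has a unique minimizer $\omega_j(\theta)$, and put $$f_T(\theta)=\mathbb E_{(x,y)\sim p_T}\big[L(h(x;\omega_j(\theta),\theta),y)\big].$$ **Estimators.** Let $D_j^{de},D_j^{tr},D_j^{val}$ be independent i.i.d. samples from $p_j(x,y)$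 of sizes $n_j^{de},n_j^{tr},n_j^{val}$, and $D_T$ an independent i.i.d. sample from $p_T(x)$ of size $n_T$. Let $\hat\omega_j(\theta)$ be a (measurable) minimizer over $\Omega$ of the empirical risk $\frac1{n_j^{tr}}\sum_{i}L(h(x^{tr}_{j,i};\omega,\theta),y^{tr}_{j,i})$. Let $\hat r_j$ be the (kernel) unconstrained least-squares importance fitting (uLSIF) estimate of $r_j$, that is, the minimizer over a reproducing kernel Hilbert space $\mathcal H$ on $\mathcal X$ of $$\frac1{2n_j^{de}}\sum_{i}w(x^{de}_{j,i})^2-\frac1{n_T}\sum_{i}w(x_{T,i})+\frac{\lambda}{2}\|w\|_{\mathcal H}^2,$$ used as it is or cut off at zero (replaced by $\max\{\hat r_j,0\}$). Here the kernel of $\mathcal H$ is continuous and bounded, $r_j$ lies in the $L^2(p_j(x))$-closure of $\mathcal H$, and $\lambda=\lambda(n_j^{de},n_T)>0$ satisfies $\lambda\to0$ and $\lambda\min(n_j^{de},n_T)\to\infty$ as $n_j^{de},n_T\to\infty$. Put $$\hat f_{IW}(\theta;D_j)=\frac1{n_j^{val}}\sum_{i=1}^{n_j^{val}}\hat r_j(x^{val}_{j,i})\,L\big(h(x^{val}_{j,i};\hat\omega_j(\theta),\theta),y^{val}_{j,i}\big).$$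 **Theorem.** Let $n_j^{val}\ge1$ be fixed. Then $\hat f_{IW}(\theta;D_j)$ is square integrable for all sample sizes, and as $n_j^{de},n_j^{tr},n_T\to\infty$ jointly, 1. $\mathbb E\big[\hat f_{IW}(\theta;D_j)\big]\to f_T(\theta)$; 2. $\displaystyle \mathbb V\big[\hat f_{IW}(\theta;D_j)\big]\to\frac1{n_j^{val}}\Big\{\mathbb E_{(x,y)\sim p_j}\Big[\big(r_j(x)L(h(x;\omega_j(\theta),\theta),y)\big)^2\Big]-f_T(\theta)^2\Big\}.$ -/

import Mathlib

open MeasureTheory ProbabilityTheory Filter Topology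

namespace CovShift

noncomputable section

section Densities

variable {𝒳 𝒴 : Type*} [MeasureSpace 𝒳] [MeasureSpace 𝒴]

/-- `p` is a joint probability density of (feature, output) with respect to volume. -/
structure IsJointDensity (p : 𝒳 × 𝒴 → ℝ) : Prop where
  measurable : Measurable p
  nonneg : ∀ z, 0 ≤ p z
  lintegral_eq_one : ∫⁻ z, ENNReal.ofReal (p z) = 1

/-- The joint distribution with density `p`. -/
def jointLaw (p : 𝒳 × 𝒴 → ℝ) : Measure (𝒳 × 𝒴) :=
  (volume : Measure (𝒳 × 𝒴)).withDensity fun z => ENNReal.ofReal (p z)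

/-- The distribution of the feature under the joint density `p`. -/
def featureLaw (p : 𝒳 × 𝒴 → ℝ) : Measure 𝒳 := (jointLaw p).map Prod.fst

/-- The marginal feature density `p(x) = ∫ p(x, y) dy`. -/
def featureDensity (p : 𝒳 × 𝒴 → ℝ) (x : 𝒳) : ℝ := ∫ y, p (x, y)

/-- The conditional output density `p(y | x) = p(x, y) / p(x)` (meaningful where `p(x) > 0`). -/
def condDensity (p : 𝒳 × 𝒴 → ℝ) (z : 𝒳 × 𝒴) : ℝ := p z / featureDensity p z.1

/-- The source has support for the target: `p_T(x) > 0` implies `p_S(x) > 0`. -/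
def SourceCoversTarget (pT pS : 𝒳 × 𝒴 → ℝ) : Prop :=
  ∀ᵐ x : 𝒳, 0 < featureDensity pT x → 0 < featureDensity pS x

/-- The conditional output densities agree, wherever that of the target is defined. -/
def SameConditional (pT pS : 𝒳 × 𝒴 → ℝ) : Prop :=
  ∀ᵐ z : 𝒳 × 𝒴, 0 < featureDensity pT z.1 → condDensity pT z = condDensity pS z

/-- The density ratio `r(x) = p_T(x) / p_S(x)` (meaningful where `p_S(x) > 0`). -/
def densityRatio (pT pS : 𝒳 × 𝒴 → ℝ) (x : 𝒳) : ℝ :=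
  featureDensity pT x / featureDensity pS x

/-- The joint law of the independent samples `(D^de, D^tr, D^val, D_T)`: the first three are
i.i.d. from the source, the last consists of i.i.d. features (without outputs) from the target. -/
def sampleLaw (pT pS : 𝒳 × 𝒴 → ℝ) (nde ntr nval nT : ℕ) :
    Measure ((Fin nde → 𝒳 × 𝒴) × (Fin ntr → 𝒳 × 𝒴) × (Fin nval → 𝒳 × 𝒴) × (Fin nT → 𝒳)) :=
  (Measure.pi fun _ => jointLaw pS).prod
    ((Measure.pi fun _ => jointLaw pS).prod
      ((Measure.pi fun _ => jointLaw pS).prod (Measure.pi fun _ => featureLaw pT)))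

end Densities

section Risk

variable {𝒳 𝒴 W Θ : Type*}

/-- The risk `E_{(X,Y) ∼ p} [L(h(X; ω, θ), Y)]`. -/
def risk [MeasureSpace 𝒳] [MeasureSpace 𝒴] (p : 𝒳 × 𝒴 → ℝ) (L : 𝒴 → 𝒴 → ℝ)
    (h : 𝒳 → W → Θ → 𝒴) (θ : Θ) (ω : W) : ℝ :=
  ∫ z, L (h z.1 ω θ) z.2 ∂(jointLaw p)

/-- The empirical risk `(1/n) ∑ᵢ L(h(xᵢ; ω, θ), yᵢ)`. -/
def empRisk (L : 𝒴 → 𝒴 → ℝ) (h : 𝒳 → W → Θ → 𝒴) (θ : Θ) {n : ℕ} (D : Fin n → 𝒳 × 𝒴)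
    (ω : W) : ℝ :=
  (1 / (n : ℝ)) * ∑ i, L (h (D i).1 ω θ) (D i).2

/-- The importance-weighted estimate `(1/n) ∑ᵢ r(xᵢ) L(h(xᵢ; ω, θ), yᵢ)` on the validation sample,
for given weights `r` and model parameter `ω`. -/
def iwEstimate (L : 𝒴 → 𝒴 → ℝ) (h : 𝒳 → W → Θ → 𝒴) (θ : Θ) (r : 𝒳 → ℝ) (ω : W)
    {n : ℕ} (D : Fin n → 𝒳 × 𝒴) : ℝ :=
  (1 / (n : ℝ)) * ∑ i, r (D i).1 * L (h (D i).1 ω θ) (D i).2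

end Risk

section Ulsif

variable {𝒳 H : Type*} [NormedAddCommGroup H] [InnerProductSpace ℝ H] [RKHS ℝ H 𝒳 ℝ]

/-- The objective of (kernel) unconstrained least-squares importance fitting over a reproducing
kernel Hilbert space `H`, with denominator (source) features `a`, numerator (target) features `b`
and regularization parameter `reg`:
`1/(2n) ∑ᵢ w(aᵢ)² - 1/m ∑ᵢ w(bᵢ) + reg/2 ‖w‖²`. -/
def ulsifObjective (reg : ℝ) {n m : ℕ} (a : Fin n → 𝒳) (b : Fin m → 𝒳) (w : H) : ℝ :=
  (1 / (2 * (n : ℝ))) * ∑ i, (w (a i)) ^ 2 - (1 / (m : ℝ)) * ∑ i, w (b i) + reg / 2 * ‖w‖ ^ 2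

/-- The source-wise importance-weighted estimate as a function of all samples
`(D^de, D^tr, D^val, D_T)`: the density ratio `cut ∘ what` is fitted on the features of `D^de` and
on `D_T`, the model parameter on `D^tr`, and the average is taken over `D^val`. -/
def sourceEstimate {𝒴 W Θ : Type*} (L : 𝒴 → 𝒴 → ℝ) (h : 𝒳 → W → Θ → 𝒴) (θ : Θ) (cut : ℝ → ℝ)
    {nde ntr nval nT : ℕ} (what : (Fin nde → 𝒳) → (Fin nT → 𝒳) → H)
    (ωhat : (Fin ntr → 𝒳 × 𝒴) → W)
    (D : (Fin nde → 𝒳 × 𝒴) × (Fin ntr → 𝒳 × 𝒴) × (Fin nval → 𝒳 × 𝒴) × (Fin nT → 𝒳)) : ℝ :=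
  iwEstimate L h θ (fun x => cut (what (fun i => (D.1 i).1) D.2.2.2 x)) (ωhat D.2.1) D.2.2.1

end Ulsif

end

end CovShift

-- Subsets of `ℝ^d` and of `ℝ` carry the restriction of Lebesgue measure.
attribute [local instance] MeasureTheory.Measure.Subtype.measureSpace

/-!
# Limits of the importance-weighted risk estimate

The estimate is an average over the validation sample of `r̂(x) L(h(x; ω̂), y)`. Its mean and
variance converge because each summand converges in mean square to the oracle summand
`r(x) L(h(x; ω), y)`, whose average has the claimed limits as exact mean and variance
(`limits_of_mean_square_convergence`): under covariate shift the target law has density `r(x)` with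
respect to the source law, so that the oracle summand has the target risk as its mean. As loss and
density ratio are bounded, mean square convergence of the summands follows from that of the two
fitted ingredients.

*Model parameter.* The strong law of large numbers in the Banach space of continuous functions on
the compact parameter space makes the empirical risk converge uniformly, almost surely. Minimizers
then converge to the unique minimizer of the source risk, and dominated convergence gives
`tendsto_integral_sq_loss_sub`.

*Density ratio.* The least-squares fit `u` solves a linear normal equation. Let `v` solve the same
equation, with unchanged weights, after one point `a` has been added to the denominator sample (of
size `n`) and one point to the numerator sample (of size `m`). Testing the difference of the two
equations with `v - u` shows that `u` and `v` differ at every point by at most `α |v(a)| + β`, where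
`α = κ² / (reg * n)`, `β = κ² / (reg * m)` and `κ²` bounds the kernel (`NormalEq.abs_sub_le`). The
added points are fresh observations for `u`, and so, averaging over which of the points is left out,
the population moments of `u` are bounded by the empirical moments of `v`. Since `v` minimizes the
empirical objective, which has the population objective of any fixed `g` as its mean up to the
penalty and factors `1 + 1/n`, `1 + 1/m`, the mean squared error of `u` is at most
`‖g - r‖² + o(1)` as soon as `α` and `β` vanish (`exists_const_integral_sq_fit_le`). No
concentration inequality is needed, which is why `reg * min n m → ∞` suffices.
-/

namespace CovShift

/-! ### Regularized least squares in a Hilbert space -/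

section NormalEquation

variable {X H : Type*} [NormedAddCommGroup H] [InnerProductSpace ℝ H]

/-- The normal equation of least-squares importance fitting for a feature map `k : X → H`, where
`w : H` is read as the function `x ↦ ⟪k x, w⟫`. The weights `p` of the denominator sample `a` and
`q` of the numerator sample `b` are kept apart from the sample sizes, so that the same weights can
be used on samples with one additional point. -/
def NormalEq (k : X → H) (reg p q : ℝ) {n m : ℕ} (a : Fin n → X) (b : Fin m → X) (u : H) : Prop :=
  ∀ z : H, p * ∑ i, inner ℝ (k (a i)) u * inner ℝ (k (a i)) z + reg * inner ℝ u z
    = q * ∑ j, inner ℝ (k (b j)) z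

variable {k : X → H} {reg p q κ : ℝ} {n m : ℕ}

lemma eq_zero_of_forall_quadratic_nonneg {A B : ℝ} (hAB : ∀ t : ℝ, 0 ≤ A * t ^ 2 + B * t) :
    B = 0 := by
  by_contra hB
  have hA : 0 ≤ A := by nlinarith [hAB 1, hAB (-1)]
  -- `A + 1` instead of `A` keeps the minimizing argument defined for `A = 0`
  have h1 := hAB (-B / (2 * (A + 1)))
  have h2 : A * (-B / (2 * (A + 1))) ^ 2 + B * (-B / (2 * (A + 1)))
      = - (B ^ 2 * (A + 2) / (4 * (A + 1) ^ 2)) := by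
    field_simp
    ring
  have h3 : 0 < B ^ 2 * (A + 2) / (4 * (A + 1) ^ 2) := by positivity
  linarith

lemma abs_inner_feature_le (hk : ∀ x, ‖k x‖ ≤ κ) (x : X) (w : H) :
    |inner ℝ (k x) w| ≤ κ * ‖w‖ :=
  (abs_real_inner_le_norm _ _).trans (mul_le_mul_of_nonneg_right (hk x) (norm_nonneg _))

lemma NormalEq.norm_le {a : Fin n → X} {b : Fin m → X} {u : H}
    (hk : ∀ x, ‖k x‖ ≤ κ) (hκ : 0 ≤ κ) (hreg : 0 < reg) (hp : 0 ≤ p) (hq : 0 ≤ q)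
    (hu : NormalEq k reg p q a b u) : ‖u‖ ≤ q * m * κ / reg := by
  have h := hu u
  rw [real_inner_self_eq_norm_sq] at h
  have h1 : 0 ≤ p * ∑ i, inner ℝ (k (a i)) u * inner ℝ (k (a i)) u :=
    mul_nonneg hp (Finset.sum_nonneg fun i _ => mul_self_nonneg _)
  have h2 : ∑ j, inner ℝ (k (b j)) u ≤ m * (κ * ‖u‖) := by
    calc ∑ j, inner ℝ (k (b j)) u ≤ ∑ _j : Fin m, κ * ‖u‖ :=
          Finset.sum_le_sum fun j _ => (le_abs_self _).trans (abs_inner_feature_le hk _ _)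
      _ = m * (κ * ‖u‖) := by simp
  have h3 : reg * ‖u‖ ^ 2 ≤ q * (m * (κ * ‖u‖)) := by
    have := mul_le_mul_of_nonneg_left h2 hq
    linarith
  rw [le_div_iff₀ hreg]
  rcases (norm_nonneg u).eq_or_lt with h0 | h0
  · rw [← h0]
    simp only [zero_mul]
    positivity
  · by_contra! hlt
    nlinarith

/-- Solutions of the normal equation minimize the associated quadratic functional. -/
lemma NormalEq.objective_le {a : Fin n → X} {b : Fin m → X} {u : H}
    (hreg : 0 < reg) (hp : 0 ≤ p) (hu : NormalEq k reg p q a b u) (g : H) :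
    p * ∑ i, (inner ℝ (k (a i)) u) ^ 2 - 2 * (q * ∑ j, inner ℝ (k (b j)) u) ≤
      p * ∑ i, (inner ℝ (k (a i)) g) ^ 2 - 2 * (q * ∑ j, inner ℝ (k (b j)) g)
        + reg * ‖g‖ ^ 2 := by
  have h1 := hu u
  have h2 := hu g
  have h3 : 0 ≤ p * ∑ i, (inner ℝ (k (a i)) g - inner ℝ (k (a i)) u) ^ 2 :=
    mul_nonneg hp (Finset.sum_nonneg fun i _ => sq_nonneg _)
  have h4 : ∑ i, (inner ℝ (k (a i)) g - inner ℝ (k (a i)) u) ^ 2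
      = ∑ i, (inner ℝ (k (a i)) g) ^ 2 - 2 * ∑ i, inner ℝ (k (a i)) u * inner ℝ (k (a i)) g
        + ∑ i, (inner ℝ (k (a i)) u) ^ 2 := by
    rw [Finset.mul_sum, ← Finset.sum_sub_distrib, ← Finset.sum_add_distrib]
    exact Finset.sum_congr rfl fun i _ => by ring
  have h5 : ∑ i, inner ℝ (k (a i)) u * inner ℝ (k (a i)) u = ∑ i, (inner ℝ (k (a i)) u) ^ 2 :=
    Finset.sum_congr rfl fun i _ => by ring
  have h6 : 0 ≤ ‖g - u‖ ^ 2 := sq_nonneg _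
  have h7 : 0 ≤ ‖u‖ ^ 2 := sq_nonneg _
  rw [norm_sub_sq_real, real_inner_comm] at h6
  rw [real_inner_self_eq_norm_sq, h5] at h1
  rw [h4] at h3
  nlinarith [mul_nonneg hreg.le h6, mul_nonneg hreg.le h7]

/-- Leave-one-out stability: removing one point from each of the two samples changes the fitted
function at most by a multiple of the value of the full fit at the removed denominator point. -/
lemma NormalEq.abs_sub_le {a : Fin (n + 1) → X} {b : Fin (m + 1) → X} {u v : H}
    (hk : ∀ x, ‖k x‖ ≤ κ) (hκ : 0 ≤ κ) (hreg : 0 < reg) (hp : 0 ≤ p) (hq : 0 ≤ q)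
    (i : Fin (n + 1)) (j : Fin (m + 1))
    (hu : NormalEq k reg p q (a ∘ i.succAbove) (b ∘ j.succAbove) u)
    (hv : NormalEq k reg p q a b v) (x : X) :
    |inner ℝ (k x) u - inner ℝ (k x) v| ≤
      κ ^ 2 / reg * p * |inner ℝ (k (a i)) v| + κ ^ 2 / reg * q := by
  -- testing both equations with `v - u`, the common sample points contribute a nonnegative term
  have h1 := hv (v - u)
  have h2 := hu (v - u)
  rw [Fin.sum_univ_succAbove _ i, Fin.sum_univ_succAbove _ j] at h1
  simp only [Function.comp_apply] at h2
  have h3 : ∑ l, inner ℝ (k (a (i.succAbove l))) v * inner ℝ (k (a (i.succAbove l))) (v - u)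
      - ∑ l, inner ℝ (k (a (i.succAbove l))) u * inner ℝ (k (a (i.succAbove l))) (v - u)
      = ∑ l, (inner ℝ (k (a (i.succAbove l))) (v - u)) ^ 2 := by
    rw [← Finset.sum_sub_distrib]
    exact Finset.sum_congr rfl fun l _ => by rw [inner_sub_right]; ring
  have h4 : (inner ℝ v (v - u) : ℝ) - inner ℝ u (v - u) = ‖v - u‖ ^ 2 := by
    rw [← inner_sub_left, real_inner_self_eq_norm_sq]
  have h5 : 0 ≤ p * ∑ l, (inner ℝ (k (a (i.succAbove l))) (v - u)) ^ 2 :=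
    mul_nonneg hp (Finset.sum_nonneg fun i _ => sq_nonneg _)
  have hb := abs_inner_feature_le hk (b j) (v - u)
  have ha := abs_inner_feature_le hk (a i) (v - u)
  have h6 : q * inner ℝ (k (b j)) (v - u) ≤ q * (κ * ‖v - u‖) :=
    mul_le_mul_of_nonneg_left ((le_abs_self _).trans hb) hq
  have h7 : - (inner ℝ (k (a i)) v * inner ℝ (k (a i)) (v - u))
      ≤ |inner ℝ (k (a i)) v| * (κ * ‖v - u‖) := by
    refine (neg_le_abs _).trans ?_
    rw [abs_mul]
    exact mul_le_mul_of_nonneg_left ha (abs_nonneg _)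
  have h8 := mul_le_mul_of_nonneg_left h7 hp
  have h9 : reg * ‖v - u‖ ^ 2 ≤ (p * |inner ℝ (k (a i)) v| + q) * κ * ‖v - u‖ := by
    rw [← h3] at h5
    rw [← h4]
    linarith
  have h10 : ‖v - u‖ ≤ (p * |inner ℝ (k (a i)) v| + q) * κ / reg := by
    rw [le_div_iff₀ hreg]
    rcases (norm_nonneg (v - u)).eq_or_lt with h0 | h0
    · rw [← h0]
      simp only [zero_mul]
      positivity
    · by_contra! hlt
      nlinarith
  rw [← inner_sub_right]
  calc |inner ℝ (k x) (u - v)| ≤ κ * ‖u - v‖ := abs_inner_feature_le hk _ _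
    _ ≤ κ * ((p * |inner ℝ (k (a i)) v| + q) * κ / reg) := by
        rw [norm_sub_rev]
        exact mul_le_mul_of_nonneg_left h10 hκ
    _ = _ := by ring

/-- Solutions of the normal equation depend continuously on the samples. -/
lemma NormalEq.continuous [TopologicalSpace X] (hk : Continuous k) (hreg : 0 < reg) (hp : 0 ≤ p)
    {sol : (Fin n → X) → (Fin m → X) → H} (hsol : ∀ a b, NormalEq k reg p q a b (sol a b)) :
    Continuous fun s : (Fin n → X) × (Fin m → X) => sol s.1 s.2 := by
  rw [continuous_iff_continuousAt]
  rintro ⟨a', b'⟩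
  set u' := sol a' b' with hu'
  -- the residual of the solution at `(a', b')` in the normal equation at `s`
  let G : (Fin n → X) × (Fin m → X) → H := fun s =>
    q • ∑ j, k (s.2 j) - p • ∑ i, (inner ℝ (k (s.1 i)) u' : ℝ) • k (s.1 i) - reg • u'
  have hGinner : ∀ s z, inner ℝ (G s) z = q * ∑ j, inner ℝ (k (s.2 j)) z
      - p * ∑ i, inner ℝ (k (s.1 i)) u' * inner ℝ (k (s.1 i)) z - reg * inner ℝ u' z := by
    intro s z
    simp only [G, inner_sub_left, real_inner_smul_left, sum_inner]
  have hG : Continuous G := by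
    refine ((continuous_finsetSum _ fun j _ => ?_).const_smul q).sub
      ((continuous_finsetSum _ fun i _ => ?_).const_smul p) |>.sub continuous_const
    · exact hk.comp ((continuous_apply j).comp continuous_snd)
    · have : Continuous fun s : (Fin n → X) × (Fin m → X) => k (s.1 i) :=
        hk.comp ((continuous_apply i).comp continuous_fst)
      exact (this.inner continuous_const).smul this
  have hG0 : G (a', b') = 0 := by
    refine ext_inner_right ℝ fun z => ?_
    rw [hGinner, inner_zero_left]
    have := hsol a' b' z
    simp only
    linarith
  have hle : ∀ s, ‖sol s.1 s.2 - u'‖ ≤ ‖G s‖ / reg := by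
    intro s
    set d := sol s.1 s.2 - u' with hd
    have h1 := hsol s.1 s.2 d
    have h2 := hGinner s d
    have h3 : ∑ i, inner ℝ (k (s.1 i)) (sol s.1 s.2) * inner ℝ (k (s.1 i)) d
        - ∑ i, inner ℝ (k (s.1 i)) u' * inner ℝ (k (s.1 i)) d
        = ∑ i, (inner ℝ (k (s.1 i)) d) ^ 2 := by
      rw [← Finset.sum_sub_distrib]
      exact Finset.sum_congr rfl fun l _ => by rw [← sub_mul, ← inner_sub_right]; ring
    have h4 : (inner ℝ (sol s.1 s.2) d : ℝ) - inner ℝ u' d = ‖d‖ ^ 2 := by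
      rw [← inner_sub_left, real_inner_self_eq_norm_sq]
    have h5 : 0 ≤ p * ∑ i, (inner ℝ (k (s.1 i)) d) ^ 2 :=
      mul_nonneg hp (Finset.sum_nonneg fun i _ => sq_nonneg _)
    have h6 := real_inner_le_norm (G s) d
    have h7 : reg * ‖d‖ ^ 2 ≤ ‖G s‖ * ‖d‖ := by
      rw [← h3] at h5
      rw [← h4]
      linarith
    rw [le_div_iff₀ hreg]
    rcases (norm_nonneg d).eq_or_lt with h0 | h0
    · rw [← h0]
      simp
    · by_contra! hlt
      nlinarith
  rw [ContinuousAt, tendsto_iff_norm_sub_tendsto_zero]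
  have hlim : Tendsto (fun s => ‖G s‖ / reg) (𝓝 (a', b')) (𝓝 0) := by
    have := (hG.norm.div_const reg).tendsto (a', b')
    simpa [hG0] using this
  exact squeeze_zero (fun _ => norm_nonneg _) hle hlim

/-- The normal equation is solvable, by the Lax-Milgram theorem. -/
lemma exists_normalEq [CompleteSpace H] (hreg : 0 < reg) (hp : 0 ≤ p)
    (a : Fin n → X) (b : Fin m → X) : ∃ u, NormalEq k reg p q a b u := by
  let B : H →L[ℝ] H →L[ℝ] ℝ :=
    p • ∑ i, ((innerSL ℝ (k (a i))).smulRight (innerSL ℝ (k (a i)))) 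
      + reg • (isBoundedBilinearMap_inner (𝕜 := ℝ)).toContinuousLinearMap
  have hB : ∀ u z, B u z =
      p * ∑ i, inner ℝ (k (a i)) u * inner ℝ (k (a i)) z + reg * inner ℝ u z := by
    intro u z
    simp [B, sum_apply]
  have hco : IsCoercive B := by
    refine ⟨reg, hreg, fun u => ?_⟩
    rw [hB, real_inner_self_eq_norm_sq]
    have : 0 ≤ p * ∑ i, inner ℝ (k (a i)) u * inner ℝ (k (a i)) u :=
      mul_nonneg hp (Finset.sum_nonneg fun i _ => mul_self_nonneg _)
    nlinarith
  refine ⟨hco.continuousLinearEquivOfBilin.symm (q • ∑ j, k (b j)), fun z => ?_⟩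
  rw [← hB, ← hco.continuousLinearEquivOfBilin_apply, ContinuousLinearEquiv.apply_symm_apply,
    real_inner_smul_left, sum_inner]

end NormalEquation

section Rkhs

variable {X H : Type*} [NormedAddCommGroup H] [InnerProductSpace ℝ H] [RKHS ℝ H X ℝ]
  [CompleteSpace H]

lemma inner_kerFun_one (x : X) (w : H) : inner ℝ (RKHS.kerFun H x (1 : ℝ)) w = w x := by
  simp

lemma continuous_kerFun_one [TopologicalSpace X]
    (hker : Continuous fun p : X × X => RKHS.kernel H p.1 p.2 (1 : ℝ)) :
    Continuous fun x : X => RKHS.kerFun H x (1 : ℝ) := by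
  obtain ⟨κ, hκ⟩ : ∃ κ : X → X → ℝ, ∀ x y, RKHS.kernel H x y (1 : ℝ) = κ x y :=
    ⟨fun x y => RKHS.kernel H x y (1 : ℝ), fun _ _ => rfl⟩
  simp_rw [hκ] at hker
  have hval : ∀ x y : X, (inner ℝ (RKHS.kerFun H x (1 : ℝ)) (RKHS.kerFun H y (1 : ℝ)) : ℝ)
      = κ x y := fun x y => by
    rw [inner_kerFun_one, RKHS.kerFun_apply, hκ]
  rw [continuous_iff_continuousAt]
  intro y
  rw [ContinuousAt, tendsto_iff_norm_sub_tendsto_zero]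
  have h1 : ∀ x, ‖RKHS.kerFun H x (1 : ℝ) - RKHS.kerFun H y (1 : ℝ)‖
      = √(κ x x - 2 * κ x y + κ y y) := by
    intro x
    rw [← hval x x, ← hval x y, ← hval y y, real_inner_self_eq_norm_sq,
      real_inner_self_eq_norm_sq, ← norm_sub_sq_real, Real.sqrt_sq (norm_nonneg _)]
  simp_rw [h1]
  have h2 : Continuous fun x : X => √(κ x x - 2 * κ x y + κ y y) := by
    have ha : Continuous fun x : X => κ x x := hker.comp (continuous_id.prodMk continuous_id)
    have hb : Continuous fun x : X => κ x y := hker.comp (continuous_id.prodMk continuous_const)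
    fun_prop
  have h3 : √(κ y y - 2 * κ y y + κ y y) = 0 := by
    rw [show κ y y - 2 * κ y y + κ y y = 0 by ring, Real.sqrt_zero]
  rw [← h3]
  exact h2.tendsto y

lemma norm_kerFun_one_le {B : ℝ} (hB : ∀ x : X, RKHS.kernel H x x (1 : ℝ) ≤ B) (x : X) :
    ‖RKHS.kerFun H x (1 : ℝ)‖ ≤ √B := by
  refine Real.le_sqrt_of_sq_le ?_
  rw [← real_inner_self_eq_norm_sq, inner_kerFun_one, RKHS.kerFun_apply]
  exact hB x

/-- Minimizers of the objective of least-squares importance fitting solve the normal equation. -/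
lemma normalEq_of_isMinOn {reg : ℝ} {n m : ℕ} {a : Fin n → X} {b : Fin m → X} {u : H}
    (hu : IsMinOn (ulsifObjective (H := H) reg a b) Set.univ u) :
    NormalEq (fun x => RKHS.kerFun H x (1 : ℝ)) reg (1 / n) (1 / m) a b u := by
  intro z
  simp_rw [inner_kerFun_one]
  have hexp : ∀ t : ℝ, ulsifObjective reg a b (u + t • z) - ulsifObjective reg a b u =
      ((1 / (2 * (n : ℝ))) * ∑ i, (z (a i)) ^ 2 + reg / 2 * ‖z‖ ^ 2) * t ^ 2
      + ((1 / n : ℝ) * ∑ i, u (a i) * z (a i) + reg * inner ℝ u z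
        - (1 / m : ℝ) * ∑ j, z (b j)) * t := by
    intro t
    simp only [ulsifObjective, RKHS.coe_add, RKHS.coe_smul, Pi.add_apply, Pi.smul_apply,
      smul_eq_mul]
    have h1 : ∑ i, (u (a i) + t * z (a i)) ^ 2 = ∑ i, (u (a i)) ^ 2
        + 2 * t * ∑ i, u (a i) * z (a i) + t ^ 2 * ∑ i, (z (a i)) ^ 2 := by
      rw [Finset.mul_sum, Finset.mul_sum, ← Finset.sum_add_distrib, ← Finset.sum_add_distrib]
      exact Finset.sum_congr rfl fun i _ => by ring
    have h2 : ∑ j, (u (b j) + t * z (b j)) = ∑ j, u (b j) + t * ∑ j, z (b j) := by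
      rw [Finset.mul_sum, ← Finset.sum_add_distrib]
    rw [h1, h2, norm_add_sq_real, norm_smul, real_inner_smul_right, mul_pow, Real.norm_eq_abs,
      sq_abs]
    have h3 : (1 : ℝ) / (2 * n) = 1 / 2 * (1 / n) := by rw [one_div_mul_one_div]
    rw [h3]
    ring
  have h0 := eq_zero_of_forall_quadratic_nonneg fun t => by
    rw [← hexp t]
    exact sub_nonneg.2 (hu (Set.mem_univ _))
  linarith

end Rkhs

/-! ### Mean consistency of the importance fit -/

section LeaveOneOut

variable {X : Type*} [MeasurableSpace X] {P Q : Measure X} [IsProbabilityMeasure P]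
  [IsProbabilityMeasure Q] {n m : ℕ}

/-- A point left out of the first of two independent i.i.d. samples is a fresh observation. -/
lemma measurePreserving_leaveOneOut_fst (i : Fin (n + 1)) (j : Fin (m + 1)) :
    MeasurePreserving
      (fun s : (Fin (n + 1) → X) × (Fin (m + 1) → X) =>
        ((s.1 ∘ i.succAbove, s.2 ∘ j.succAbove), s.1 i))
      ((Measure.pi fun _ => P).prod (Measure.pi fun _ => Q))
      (((Measure.pi fun _ => P).prod (Measure.pi fun _ => Q)).prod P) := by
  have h1 := measurePreserving_piFinSuccAbove (fun _ : Fin (n + 1) => P) i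
  have h2 := (measurePreserving_snd (μ := Q) (ν := Measure.pi fun _ : Fin m => Q)).comp
    (measurePreserving_piFinSuccAbove (fun _ : Fin (m + 1) => Q) j)
  have h3 := h1.prod h2
  exact (Measure.measurePreserving_swap.comp (measurePreserving_prodAssoc _ _ _)).comp h3

/-- A point left out of the second of two independent i.i.d. samples is a fresh observation. -/
lemma measurePreserving_leaveOneOut_snd (i : Fin (n + 1)) (j : Fin (m + 1)) :
    MeasurePreserving
      (fun s : (Fin (n + 1) → X) × (Fin (m + 1) → X) =>
        ((s.1 ∘ i.succAbove, s.2 ∘ j.succAbove), s.2 j))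
      ((Measure.pi fun _ => P).prod (Measure.pi fun _ => Q))
      (((Measure.pi fun _ => P).prod (Measure.pi fun _ => Q)).prod Q) := by
  have h1 := (measurePreserving_snd (μ := P) (ν := Measure.pi fun _ : Fin n => P)).comp
    (measurePreserving_piFinSuccAbove (fun _ : Fin (n + 1) => P) i)
  have h2 := Measure.measurePreserving_swap.comp
    (measurePreserving_piFinSuccAbove (fun _ : Fin (m + 1) => Q) j)
  have h3 := h1.prod h2
  exact ((measurePreserving_prodAssoc _ _ _).symm).comp h3

/-- The moments of a fit on two samples, compared with those of the fit on samples with one more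
point each. Here `a2`, `a1`, `b` stand for the mean square and the mean absolute value of the larger
fit on its denominator sample and its mean value on its numerator sample, `U2`, `U1` for the same
moments of the smaller fit at a fresh denominator point, and `Uq` for its mean at a fresh numerator
point. `α`, `β` are the stability constants, `1 + γ` and `1 + δ` the ratios of the sample sizes, and
`R` bounds twice the unpenalized objective of the larger fit. -/
lemma exists_const_excess_bound {C : ℝ} (hC : 0 ≤ C) : ∃ K : ℝ, 0 ≤ K ∧
    ∀ α β γ δ a2 a1 b U2 U1 Uq R : ℝ, 0 ≤ α → α ≤ 1 → 0 ≤ β → β ≤ 1 → 0 ≤ γ → 0 ≤ δ → δ ≤ 1 →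
    0 ≤ a2 → 0 ≤ a1 →
    (∀ D, 2 * D * a1 ≤ a2 + D ^ 2) →
    U2 ≤ (1 + α) ^ 2 * a2 + 2 * (1 + α) * β * a1 + β ^ 2 →
    U1 ≤ (1 + α) * a1 + β →
    Uq ≤ C * U1 →
    b - α * a1 - β ≤ Uq →
    (1 + γ) * a2 ≤ (1 + δ) * b →
    (1 + γ) * a2 - 2 * ((1 + δ) * b) ≤ R →
    U2 - 2 * Uq ≤ R + K * (α + β + δ) := by
  -- `k2`, `k1`, `k3` bound `a2`, `a1`, `b`
  set D := 4 * C + 2 with hD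
  set k2 := D ^ 2 + 2 * D with hk2
  set k1 := (k2 + 1) / 2 with hk1
  set k3 := C * (2 * k1 + 1) + k1 + 1 with hk3
  have hD0 : 0 ≤ D := by positivity
  have hk20 : 0 ≤ k2 := by positivity
  have hk10 : 0 ≤ k1 := by positivity
  have hk30 : 0 ≤ k3 := by positivity
  refine ⟨3 * k2 + 6 * k1 + 3 + 2 * k3, by positivity, ?_⟩
  intro α β γ δ a2 a1 b U2 U1 Uq R hα0 hα1 hβ0 hβ1 hγ0 hδ0 hδ1 ha2 ha1 hDa hU2 hU1 hUqC hUq hen hR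
  have hαa1 : α * a1 ≤ a1 := mul_le_of_le_one_left ha1 hα1
  have hCU : C * U1 ≤ C * (2 * a1 + 1) := mul_le_mul_of_nonneg_left (by linarith) hC
  have hbU : b ≤ C * (2 * a1 + 1) + a1 + 1 := by linarith
  have hγa2 : 0 ≤ γ * a2 := mul_nonneg hγ0 ha2
  have hb0 : 0 ≤ b := by
    by_contra! hb
    have h1 : (1 + δ) * b < 0 := mul_neg_of_pos_of_neg (by linarith) hb
    linarith
  have hδb : δ * b ≤ b := mul_le_of_le_one_left hb0 hδ1
  have h1 : a2 ≤ 2 * b := by linarith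
  have h2 : a2 ≤ D * a1 + D := by
    have : D * a1 = 4 * (C * a1) + 2 * a1 := by rw [hD]; ring
    linarith
  have h3 : a2 ≤ k2 := by linarith [hDa D]
  have h4 : a1 ≤ k1 := by linarith [hDa 1]
  have h5 : b ≤ k3 := by
    have := mul_le_mul_of_nonneg_left (show 2 * a1 + 1 ≤ 2 * k1 + 1 by linarith) hC
    linarith
  clear_value k3 k1 k2 D
  have hαα : α ^ 2 ≤ α := by nlinarith
  have hββ : β ^ 2 ≤ β := by nlinarith
  have e1 : (2 * α + α ^ 2) * a2 ≤ 3 * α * k2 := by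
    calc (2 * α + α ^ 2) * a2 ≤ (3 * α) * a2 := by
          exact mul_le_mul_of_nonneg_right (by linarith) ha2
      _ ≤ _ := mul_le_mul_of_nonneg_left h3 (by positivity)
  have e2 : 2 * (1 + α) * β * a1 ≤ 4 * β * k1 := by
    calc 2 * (1 + α) * β * a1 ≤ (4 * β) * a1 := by
          exact mul_le_mul_of_nonneg_right (by nlinarith) ha1
      _ ≤ _ := mul_le_mul_of_nonneg_left h4 (by positivity)
  have e3 : α * a1 ≤ α * k1 := mul_le_mul_of_nonneg_left h4 hα0
  have e4 : δ * b ≤ δ * k3 := mul_le_mul_of_nonneg_left h5 hδ0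
  have e5 : U2 - 2 * Uq ≤ R + (3 * α * k2 + 4 * β * k1 + 3 * β + 2 * (α * k1) + 2 * (δ * k3)) := by
    linarith
  refine e5.trans ?_
  have p1 : 0 ≤ α * k3 := mul_nonneg hα0 hk30
  have p2 : 0 ≤ β * k3 := mul_nonneg hβ0 hk30
  have p3 : 0 ≤ δ * k2 := mul_nonneg hδ0 hk20
  have p4 : 0 ≤ δ * k1 := mul_nonneg hδ0 hk10
  have p5 : 0 ≤ α * k1 := mul_nonneg hα0 hk10
  have p6 : 0 ≤ β * k1 := mul_nonneg hβ0 hk10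
  have p7 : 0 ≤ β * k2 := mul_nonneg hβ0 hk20
  linarith

end LeaveOneOut

section Consistency

variable {X : Type*} [TopologicalSpace X] [SecondCountableTopology X] [MeasurableSpace X]
  [BorelSpace X] {P Q : Measure X} [IsProbabilityMeasure P] [IsProbabilityMeasure Q]
  {H : Type*} [NormedAddCommGroup H] [InnerProductSpace ℝ H]
  {k : X → H} {κ C : ℝ} {r : X → ℝ}

lemma integrable_of_continuous_of_bound {Z : Type*} [TopologicalSpace Z]
    [SecondCountableTopology Z] [MeasurableSpace Z] [OpensMeasurableSpace Z] {μ : Measure Z}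
    [IsFiniteMeasure μ] {f : Z → ℝ} (hf : Continuous f) {B : ℝ} (hB : ∀ z, |f z| ≤ B) :
    Integrable f μ :=
  Integrable.of_bound hf.aestronglyMeasurable B (ae_of_all _ hB)

lemma integral_comp_of_measurePreserving {Y Z : Type*} [MeasurableSpace Y] [MeasurableSpace Z]
    {μ : Measure Y} {ν : Measure Z} {φ : Y → Z} (h : MeasurePreserving φ μ ν) {f : Z → ℝ}
    (hf : AEStronglyMeasurable f ν) : ∫ y, f (φ y) ∂μ = ∫ z, f z ∂ν := by
  rw [← h.map_eq] at hf ⊢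
  exact (integral_map h.measurable.aemeasurable hf).symm

lemma le_average_of_forall_le {n : ℕ} {U A B c : ℝ} {f g : Fin (n + 1) → ℝ}
    (hU : ∀ i, U ≤ A * f i + B * g i + c) :
    U ≤ A * ((∑ i, f i) / (n + 1)) + B * ((∑ i, g i) / (n + 1)) + c := by
  have h1 : ∑ _i : Fin (n + 1), U ≤ ∑ i, (A * f i + B * g i + c) :=
    Finset.sum_le_sum fun i _ => hU i
  simp only [Finset.sum_const, Finset.card_univ, Fintype.card_fin, nsmul_eq_mul,
    Finset.sum_add_distrib, ← Finset.mul_sum] at h1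
  push_cast at h1
  have hn : (0 : ℝ) < n + 1 := by positivity
  have h2 : A * ((∑ i, f i) / (n + 1)) + B * ((∑ i, g i) / (n + 1)) + c
      = (A * ∑ i, f i + B * ∑ i, g i + (n + 1) * c) / (n + 1) := by
    field_simp
  rw [h2, le_div_iff₀ hn]
  linarith

lemma integral_eq_integral_mul_of_withDensity {Z : Type*} [MeasurableSpace Z] {μ ν : Measure Z}
    {r : Z → ℝ} (hr : Measurable r) (hr0 : ∀ x, 0 ≤ r x)
    (hν : ν = μ.withDensity fun x => ENNReal.ofReal (r x)) (f : Z → ℝ) :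
    ∫ x, f x ∂ν = ∫ x, r x * f x ∂μ := by
  rw [hν, integral_withDensity_eq_integral_toReal_smul hr.ennreal_ofReal
    (ae_of_all _ fun _ => ENNReal.ofReal_lt_top)]
  simp [ENNReal.toReal_ofReal (hr0 _)]

/-- Finite-sample bound for the mean squared error of the importance fit: up to an error that
vanishes with `1 / (reg * n)`, `1 / (reg * m)` and `1 / m`, the fit does as well as any fixed
element of the Hilbert space. -/
theorem exists_const_integral_sq_fit_le [CompleteSpace H]
    (hk : Continuous k) (hkb : ∀ x, ‖k x‖ ≤ κ) (hκ : 0 ≤ κ)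
    (hr : Measurable r) (hr0 : ∀ x, 0 ≤ r x) (hrC : ∀ x, r x ≤ C) (hC : 0 ≤ C)
    (hQ : Q = P.withDensity fun x => ENNReal.ofReal (r x)) :
    ∃ K : ℝ, 0 ≤ K ∧ ∀ (n m : ℕ) (reg : ℝ), 0 < n → 0 < m → 0 < reg →
      κ ^ 2 / reg * (1 / n) ≤ 1 → κ ^ 2 / reg * (1 / m) ≤ 1 →
      ∀ sol : (Fin n → X) → (Fin m → X) → H,
      (∀ a b, NormalEq k reg (1 / n) (1 / m) a b (sol a b)) → ∀ g : H,
      ∫ z, (inner ℝ (k z.2) (sol z.1.1 z.1.2) - r z.2) ^ 2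
        ∂(((Measure.pi fun _ : Fin n => P).prod (Measure.pi fun _ : Fin m => Q)).prod P) ≤
      (1 + 1 / (n : ℝ)) * ∫ x, (inner ℝ (k x) g) ^ 2 ∂P
        - 2 * ((1 + 1 / (m : ℝ)) * ∫ x, r x * inner ℝ (k x) g ∂P) + reg * ‖g‖ ^ 2
        + ∫ x, r x ^ 2 ∂P
        + K * (κ ^ 2 / reg * (1 / n) + κ ^ 2 / reg * (1 / m) + 1 / m) := by
  obtain ⟨K, hK0, hK⟩ := exists_const_excess_bound hC
  refine ⟨K, hK0, ?_⟩
  intro n m reg hn hm hreg hα1 hβ1 sol hsol g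
  have hn' : (0 : ℝ) < n := by exact_mod_cast hn
  have hm' : (0 : ℝ) < m := by exact_mod_cast hm
  have hm1 : (1 : ℝ) ≤ m := by exact_mod_cast hm
  set p : ℝ := 1 / n with hp
  set q : ℝ := 1 / m with hq
  have hp0 : 0 ≤ p := by positivity
  have hq0 : 0 ≤ q := by positivity
  have hq1 : q ≤ 1 := by rw [hq, div_le_one hm']; exact hm1
  set α := κ ^ 2 / reg * p with hα
  set β := κ ^ 2 / reg * q with hβ
  have hα0 : 0 ≤ α := by positivity
  have hβ0 : 0 ≤ β := by positivity
  set ν := (Measure.pi fun _ : Fin n => P).prod (Measure.pi fun _ : Fin m => Q) with hν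
  -- the fit on samples with one additional point each
  choose sol' hsol' using fun (a : Fin (n + 1) → X) (b : Fin (m + 1) → X) =>
    exists_normalEq (k := k) (q := q) hreg hp0 a b
  set μ := (Measure.pi fun _ : Fin (n + 1) => P).prod (Measure.pi fun _ : Fin (m + 1) => Q) with hμ
  have hsolc := NormalEq.continuous hk hreg hp0 hsol
  have hsolc' := NormalEq.continuous hk hreg hp0 hsol'
  let u : ((Fin n → X) × (Fin m → X)) × X → ℝ := fun z => inner ℝ (k z.2) (sol z.1.1 z.1.2)
  have hu : Continuous u := (hk.comp continuous_snd).inner (hsolc.comp continuous_fst)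
  obtain ⟨B, hB⟩ : ∃ B, ∀ z, |u z| ≤ B := by
    refine ⟨κ * (q * m * κ / reg), fun z => ?_⟩
    exact (abs_inner_feature_le hkb _ _).trans
      (mul_le_mul_of_nonneg_left ((hsol _ _).norm_le hkb hκ hreg hp0 hq0) hκ)
  let va : Fin (n + 1) → (Fin (n + 1) → X) × (Fin (m + 1) → X) → ℝ :=
    fun i s => inner ℝ (k (s.1 i)) (sol' s.1 s.2)
  let vb : Fin (m + 1) → (Fin (n + 1) → X) × (Fin (m + 1) → X) → ℝ :=
    fun j s => inner ℝ (k (s.2 j)) (sol' s.1 s.2)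
  have hva : ∀ i, Continuous (va i) := fun i =>
    (hk.comp ((continuous_apply i).comp continuous_fst)).inner hsolc'
  have hvb : ∀ j, Continuous (vb j) := fun j =>
    (hk.comp ((continuous_apply j).comp continuous_snd)).inner hsolc'
  obtain ⟨B', hB'⟩ : ∃ B,
      ∀ s x, |inner ℝ (k x) (sol' (Prod.fst s) (Prod.snd s))| ≤ B := by
    refine ⟨κ * (q * (m + 1 : ℕ) * κ / reg), fun s x => ?_⟩
    exact (abs_inner_feature_le hkb _ _).trans
      (mul_le_mul_of_nonneg_left ((hsol' _ _).norm_le hkb hκ hreg hp0 hq0) hκ)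
  have hvaI : ∀ i, Integrable (fun s => |va i s|) μ := fun i =>
    integrable_of_continuous_of_bound (hva i).abs (B := B') fun s => by
      rw [abs_abs]; exact hB' s _
  have hva2I : ∀ i, Integrable (fun s => (va i s) ^ 2) μ := fun i =>
    integrable_of_continuous_of_bound ((hva i).pow 2) (B := B' ^ 2) fun s => by
      rw [abs_pow]; exact pow_le_pow_left₀ (abs_nonneg _) (hB' s _) 2
  have hvbI : ∀ j, Integrable (vb j) μ := fun j =>
    integrable_of_continuous_of_bound (hvb j) (B := B') fun s => hB' s _
  have huI : ∀ ρ : Measure (((Fin n → X) × (Fin m → X)) × X), IsFiniteMeasure ρ →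
      Integrable u ρ := fun ρ _ => integrable_of_continuous_of_bound hu hB
  have hu2I : Integrable (fun z => (u z) ^ 2) (ν.prod P) :=
    integrable_of_continuous_of_bound (hu.pow 2) (B := B ^ 2) fun s => by
      rw [abs_pow]; exact pow_le_pow_left₀ (abs_nonneg _) (hB s) 2
  -- leave-one-out comparison of the two fits
  have hstab : ∀ (i : Fin (n + 1)) (j : Fin (m + 1)) s x,
      |u ((s.1 ∘ i.succAbove, s.2 ∘ j.succAbove), x) - inner ℝ (k x) (sol' s.1 s.2)|
        ≤ α * |va i s| + β := fun i j s x =>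
    NormalEq.abs_sub_le hkb hκ hreg hp0 hq0 i j (hsol _ _) (hsol' _ _) x
  have hfst : ∀ (i : Fin (n + 1)) (j : Fin (m + 1)) (f : ((Fin n → X) × (Fin m → X)) × X → ℝ),
      Continuous f → ∫ z, f z ∂(ν.prod P)
        = ∫ s, f ((s.1 ∘ i.succAbove, s.2 ∘ j.succAbove), s.1 i) ∂μ := by
    intro i j f hf
    exact (integral_comp_of_measurePreserving (measurePreserving_leaveOneOut_fst i j)
      hf.aestronglyMeasurable).symm
  have hsnd : ∀ (i : Fin (n + 1)) (j : Fin (m + 1)) (f : ((Fin n → X) × (Fin m → X)) × X → ℝ),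
      Continuous f → ∫ z, f z ∂(ν.prod Q)
        = ∫ s, f ((s.1 ∘ i.succAbove, s.2 ∘ j.succAbove), s.2 j) ∂μ := by
    intro i j f hf
    exact (integral_comp_of_measurePreserving (measurePreserving_leaveOneOut_snd i j)
      hf.aestronglyMeasurable).symm
  have hcompI : ∀ (f : ((Fin n → X) × (Fin m → X)) × X → ℝ), Continuous f →
      ∀ (D : ℝ), (∀ z, |f z| ≤ D) → ∀ (i : Fin (n + 1)) (j : Fin (m + 1)),
      Integrable (fun s => f ((s.1 ∘ i.succAbove, s.2 ∘ j.succAbove), s.1 i)) μ ∧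
      Integrable (fun s => f ((s.1 ∘ i.succAbove, s.2 ∘ j.succAbove), s.2 j)) μ := by
    intro f hf D hD i j
    constructor
    · exact integrable_of_continuous_of_bound (hf.comp (by fun_prop)) fun s => hD _
    · exact integrable_of_continuous_of_bound (hf.comp (by fun_prop)) fun s => hD _
  let e2 : Fin (n + 1) → ℝ := fun i => ∫ s, (va i s) ^ 2 ∂μ
  let e1 : Fin (n + 1) → ℝ := fun i => ∫ s, |va i s| ∂μ
  let f1 : Fin (m + 1) → ℝ := fun j => ∫ s, vb j s ∂μ
  have hU2 : ∀ i, ∫ z, (u z) ^ 2 ∂(ν.prod P)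
      ≤ (1 + α) ^ 2 * e2 i + 2 * (1 + α) * β * e1 i + β ^ 2 := by
    intro i
    rw [hfst i 0 (fun z => u z ^ 2) (hu.pow 2)]
    have hrhs : (1 + α) ^ 2 * e2 i + 2 * (1 + α) * β * e1 i + β ^ 2
        = ∫ s, ((1 + α) ^ 2 * (va i s) ^ 2 + 2 * (1 + α) * β * |va i s| + β ^ 2) ∂μ := by
      have hI1 : Integrable
          (fun s => (1 + α) ^ 2 * (va i s) ^ 2 + 2 * (1 + α) * β * |va i s|) μ :=
        ((hva2I i).const_mul _).add ((hvaI i).const_mul _)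
      rw [integral_add hI1 (integrable_const _),
        integral_add ((hva2I i).const_mul _) ((hvaI i).const_mul _), integral_const_mul,
        integral_const_mul]
      simp [e2, e1]
    rw [hrhs]
    refine integral_mono ?_ ((((hva2I i).const_mul _).add ((hvaI i).const_mul _)).add
      (integrable_const _)) fun s => ?_
    · refine (hcompI (fun z => u z ^ 2) (hu.pow 2) (B ^ 2) (fun z => ?_) i 0).1
      rw [abs_pow]; exact pow_le_pow_left₀ (abs_nonneg _) (hB z) 2
    · have h1 := hstab i 0 s (s.1 i)
      have h2 : |u ((s.1 ∘ i.succAbove, s.2 ∘ (0 : Fin (m + 1)).succAbove), s.1 i)|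
          ≤ (1 + α) * |va i s| + β := by
        have := abs_sub_abs_le_abs_sub
          (u ((s.1 ∘ i.succAbove, s.2 ∘ (0 : Fin (m + 1)).succAbove), s.1 i)) (va i s)
        have h1' : |u ((s.1 ∘ i.succAbove, s.2 ∘ (0 : Fin (m + 1)).succAbove), s.1 i) - va i s|
          ≤ α * |va i s| + β := h1
        linarith
      calc _ = |u ((s.1 ∘ i.succAbove, s.2 ∘ (0 : Fin (m + 1)).succAbove), s.1 i)| ^ 2 :=
            (sq_abs _).symm
        _ ≤ ((1 + α) * |va i s| + β) ^ 2 := pow_le_pow_left₀ (abs_nonneg _) h2 2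
        _ = _ := by rw [← sq_abs (va i s)]; ring
  have hU1 : ∀ i, ∫ z, |u z| ∂(ν.prod P) ≤ (1 + α) * e1 i + β := by
    intro i
    rw [hfst i 0 (fun z => |u z|) hu.abs]
    have hrhs : (1 + α) * e1 i + β = ∫ s, ((1 + α) * |va i s| + β) ∂μ := by
      rw [integral_add ((hvaI i).const_mul _) (integrable_const _), integral_const_mul]
      simp [e1]
    rw [hrhs]
    refine integral_mono ?_ (((hvaI i).const_mul _).add (integrable_const _)) fun s => ?_
    · exact (hcompI (fun z => |u z|) hu.abs B (fun z => by rw [abs_abs]; exact hB z) i 0).1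
    · have h1 : |u ((s.1 ∘ i.succAbove, s.2 ∘ (0 : Fin (m + 1)).succAbove), s.1 i) - va i s|
          ≤ α * |va i s| + β := hstab i 0 s (s.1 i)
      have := abs_sub_abs_le_abs_sub
          (u ((s.1 ∘ i.succAbove, s.2 ∘ (0 : Fin (m + 1)).succAbove), s.1 i)) (va i s)
      simp only
      linarith
  have hUq : ∀ i j, f1 j - α * e1 i - β ≤ ∫ z, u z ∂(ν.prod Q) := by
    intro i j
    rw [hsnd i j _ hu]
    have hI1 : Integrable (fun s => vb j s - α * |va i s|) μ :=
      (hvbI j).sub ((hvaI i).const_mul _)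
    have hI2 : Integrable (fun s => vb j s - α * |va i s| - β) μ :=
      hI1.sub (integrable_const _)
    have hlhs : f1 j - α * e1 i - β = ∫ s, (vb j s - α * |va i s| - β) ∂μ := by
      rw [integral_sub hI1 (integrable_const _),
        integral_sub (hvbI j) ((hvaI i).const_mul _), integral_const_mul]
      simp [f1, e1]
    rw [hlhs]
    refine integral_mono hI2 (hcompI u hu B hB i j).2 fun s => ?_
    have h1 : |u ((s.1 ∘ i.succAbove, s.2 ∘ j.succAbove), s.2 j) - vb j s|
          ≤ α * |va i s| + β := hstab i j s (s.2 j)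
    have := (abs_le.1 h1).1
    simp only
    linarith
  have hruI : Integrable (fun z : ((Fin n → X) × (Fin m → X)) × X => r z.2 * u z)
      (ν.prod P) := by
    refine Integrable.of_bound ((hr.comp measurable_snd).mul
      hu.measurable).aestronglyMeasurable (C * B) (ae_of_all _ fun z => ?_)
    rw [norm_mul, Real.norm_eq_abs, Real.norm_eq_abs, abs_of_nonneg (hr0 _)]
    exact mul_le_mul (hrC _) (hB _) (abs_nonneg _) hC
  have hUqr : ∫ z, u z ∂(ν.prod Q) = ∫ z, r z.2 * u z ∂(ν.prod P) := by
    rw [integral_prod _ (huI _ inferInstance), integral_prod _ hruI]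
    exact integral_congr_ae (ae_of_all _ fun s =>
      integral_eq_integral_mul_of_withDensity hr hr0 hQ _)
  have hUqC : ∫ z, u z ∂(ν.prod Q) ≤ C * ∫ z, |u z| ∂(ν.prod P) := by
    rw [hUqr, ← integral_const_mul]
    refine integral_mono hruI ((huI _ inferInstance).abs.const_mul C) fun z => ?_
    calc r z.2 * u z ≤ r z.2 * |u z| := mul_le_mul_of_nonneg_left (le_abs_self _) (hr0 _)
      _ ≤ C * |u z| := mul_le_mul_of_nonneg_right (hrC _) (abs_nonneg _)
  -- the error in terms of the moments of the fit
  have hr2I : Integrable (fun z : ((Fin n → X) × (Fin m → X)) × X => (r z.2) ^ 2)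
      (ν.prod P) := by
    refine Integrable.of_bound ((hr.comp measurable_snd).pow_const 2).aestronglyMeasurable
      (C ^ 2) (ae_of_all _ fun z => ?_)
    rw [norm_pow, Real.norm_eq_abs, abs_of_nonneg (hr0 _)]
    exact pow_le_pow_left₀ (hr0 _) (hrC _) 2
  have hrisk : ∫ z, (u z - r z.2) ^ 2 ∂(ν.prod P) =
      ∫ z, (u z) ^ 2 ∂(ν.prod P) - 2 * ∫ z, u z ∂(ν.prod Q) + ∫ x, (r x) ^ 2 ∂P := by
    have h1 : ∫ x, (r x) ^ 2 ∂P = ∫ z, (r z.2) ^ 2 ∂(ν.prod P) := by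
      rw [integral_prod _ hr2I]
      simp
    have hI : Integrable (fun z => (u z) ^ 2 - 2 * (r z.2 * u z)) (ν.prod P) :=
      hu2I.sub (hruI.const_mul 2)
    rw [hUqr, h1, ← integral_const_mul, ← integral_sub hu2I (hruI.const_mul 2),
      ← integral_add hI hr2I]
    exact integral_congr_ae (ae_of_all _ fun z => by simp only; ring)
  -- energy identity and optimality of the larger fit, in the mean
  have hsumA : ∫ s, p * ∑ i, (va i s) ^ 2 ∂μ = p * ∑ i, e2 i := by
    rw [integral_const_mul, integral_finsetSum _ fun i _ => hva2I i]
  have hsumB : ∫ s, q * ∑ j, vb j s ∂μ = q * ∑ j, f1 j := by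
    rw [integral_const_mul, integral_finsetSum _ fun j _ => hvbI j]
  have hIA : Integrable (fun s => p * ∑ i, (va i s) ^ 2) μ :=
    (integrable_finsetSum _ fun i _ => hva2I i).const_mul p
  have hIB : Integrable (fun s => q * ∑ j, vb j s) μ :=
    (integrable_finsetSum _ fun j _ => hvbI j).const_mul q
  have henergy : p * ∑ i, e2 i ≤ q * ∑ j, f1 j := by
    rw [← hsumA, ← hsumB]
    refine integral_mono hIA hIB fun s => ?_
    have h1 := hsol' s.1 s.2 (sol' s.1 s.2)
    rw [real_inner_self_eq_norm_sq] at h1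
    have h2 : 0 ≤ reg * ‖sol' s.1 s.2‖ ^ 2 := by positivity
    have h3 : ∑ i, (va i s) ^ 2 = ∑ i, inner ℝ (k (s.1 i)) (sol' s.1 s.2)
        * inner ℝ (k (s.1 i)) (sol' s.1 s.2) := Finset.sum_congr rfl fun i _ => by
      simp only [va]; ring
    simp only [h3, vb]
    linarith
  have hkgc : Continuous fun x => (inner ℝ (k x) g : ℝ) := hk.inner continuous_const
  have hkgb : ∀ x, |(inner ℝ (k x) g : ℝ)| ≤ κ * ‖g‖ := fun x => abs_inner_feature_le hkb x g
  have hga : ∀ i : Fin (n + 1), Integrable (fun s : (Fin (n + 1) → X) × (Fin (m + 1) → X) =>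
        (inner ℝ (k (s.1 i)) g : ℝ) ^ 2) μ ∧
      ∫ s, (inner ℝ (k (s.1 i)) g : ℝ) ^ 2 ∂μ = ∫ x, (inner ℝ (k x) g) ^ 2 ∂P := by
    intro i
    have h : MeasurePreserving (fun s : (Fin (n + 1) → X) × (Fin (m + 1) → X) => s.1 i) μ P :=
      (measurePreserving_eval (fun _ => P) i).comp measurePreserving_fst
    have hI : Integrable (fun x => (inner ℝ (k x) g : ℝ) ^ 2) P :=
      integrable_of_continuous_of_bound (hkgc.pow 2) (B := (κ * ‖g‖) ^ 2) fun s => by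
        rw [abs_pow]; exact pow_le_pow_left₀ (abs_nonneg _) (hkgb s) 2
    exact ⟨h.integrable_comp_of_integrable hI,
      integral_comp_of_measurePreserving h hI.aestronglyMeasurable⟩
  have hgb : ∀ j : Fin (m + 1), Integrable (fun s : (Fin (n + 1) → X) × (Fin (m + 1) → X) =>
        (inner ℝ (k (s.2 j)) g : ℝ)) μ ∧
      ∫ s, (inner ℝ (k (s.2 j)) g : ℝ) ∂μ = ∫ x, r x * inner ℝ (k x) g ∂P := by
    intro j
    have h : MeasurePreserving (fun s : (Fin (n + 1) → X) × (Fin (m + 1) → X) => s.2 j) μ Q :=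
      (measurePreserving_eval (fun _ => Q) j).comp measurePreserving_snd
    have hI : Integrable (fun x => (inner ℝ (k x) g : ℝ)) Q :=
      integrable_of_continuous_of_bound hkgc hkgb
    refine ⟨h.integrable_comp_of_integrable hI, ?_⟩
    rw [← integral_eq_integral_mul_of_withDensity hr hr0 hQ]
    exact integral_comp_of_measurePreserving h hI.aestronglyMeasurable
  have hobj : p * ∑ i, e2 i - 2 * (q * ∑ j, f1 j) ≤
      p * ((n + 1) * ∫ x, (inner ℝ (k x) g) ^ 2 ∂P)
        - 2 * (q * ((m + 1) * ∫ x, r x * inner ℝ (k x) g ∂P)) + reg * ‖g‖ ^ 2 := by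
    have hIGa := (integrable_finsetSum Finset.univ fun i _ => (hga i).1).const_mul p
    have hIGb := ((integrable_finsetSum Finset.univ fun j _ => (hgb j).1).const_mul q).const_mul 2
    have hGa : ∫ s, p * ∑ i : Fin (n + 1), (inner ℝ (k (s.1 i)) g : ℝ) ^ 2 ∂μ
        = p * ((n + 1) * ∫ x, (inner ℝ (k x) g) ^ 2 ∂P) := by
      rw [integral_const_mul, integral_finsetSum _ fun i _ => (hga i).1]
      simp [fun i => (hga i).2]
    have hGb : ∫ s, q * ∑ j : Fin (m + 1), (inner ℝ (k (s.2 j)) g : ℝ) ∂μ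
        = q * ((m + 1) * ∫ x, r x * inner ℝ (k x) g ∂P) := by
      rw [integral_const_mul, integral_finsetSum _ fun j _ => (hgb j).1]
      simp [fun i => (hgb i).2]
    have hIG : Integrable (fun s : (Fin (n + 1) → X) × (Fin (m + 1) → X) =>
        p * ∑ i, (inner ℝ (k (s.1 i)) g : ℝ) ^ 2 - 2 * (q * ∑ j, (inner ℝ (k (s.2 j)) g : ℝ))) μ :=
      hIGa.sub hIGb
    have hc : reg * ‖g‖ ^ 2 = ∫ _s, reg * ‖g‖ ^ 2 ∂μ := by simp
    rw [← hsumA, ← hsumB, ← hGa, ← hGb, hc, ← integral_const_mul, ← integral_const_mul,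
      ← integral_sub hIA (hIB.const_mul 2), ← integral_sub hIGa hIGb,
      ← integral_add hIG (integrable_const _)]
    refine integral_mono (hIA.sub (hIB.const_mul 2)) (hIG.add (integrable_const _))
      fun s => ?_
    exact (hsol' s.1 s.2).objective_le hreg hp0 g
  have he2 : ∀ i, 0 ≤ e2 i := fun i => integral_nonneg fun s => sq_nonneg _
  have he1 : ∀ i, 0 ≤ e1 i := fun i => integral_nonneg fun s => abs_nonneg _
  have hD : ∀ (D : ℝ) (i : Fin (n + 1)), 2 * D * e1 i ≤ 1 * e2 i + 0 * e2 i + D ^ 2 := by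
    intro D i
    have hrhs : 1 * e2 i + 0 * e2 i + D ^ 2 = ∫ s, ((va i s) ^ 2 + D ^ 2) ∂μ := by
      rw [integral_add (hva2I i) (integrable_const _)]
      simp [e2]
    rw [hrhs, ← integral_const_mul]
    refine integral_mono ((hvaI i).const_mul _) ((hva2I i).add (integrable_const _)) fun s => ?_
    have := sq_nonneg (|va i s| - D)
    rw [sub_sq, sq_abs] at this
    simp only
    linarith
  have hn1 : (0 : ℝ) < n + 1 := by positivity
  have hpn : (1 + p) / (n + 1) = p := by rw [hp]; field_simp
  have hqm : (1 + q) / (m + 1) = q := by rw [hq]; field_simp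
  have hpe : (1 + p) * ((∑ i, e2 i) / (n + 1)) = p * ∑ i, e2 i := by
    rw [mul_div_left_comm, hpn, mul_comm]
  have hqe : (1 + q) * ((∑ j, f1 j) / (m + 1)) = q * ∑ j, f1 j := by
    rw [mul_div_left_comm, hqm, mul_comm]
  have hpn' : p * (n + 1) = 1 + p := by rw [hp]; field_simp
  have hqm' : q * (m + 1) = 1 + q := by rw [hq]; field_simp
  have hmain := hK α β p q ((∑ i, e2 i) / (n + 1)) ((∑ i, e1 i) / (n + 1))
    ((∑ j, f1 j) / (m + 1)) (∫ z, (u z) ^ 2 ∂(ν.prod P)) (∫ z, |u z| ∂(ν.prod P))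
    (∫ z, u z ∂(ν.prod Q))
    (p * ((n + 1) * ∫ x, (inner ℝ (k x) g) ^ 2 ∂P)
        - 2 * (q * ((m + 1) * ∫ x, r x * inner ℝ (k x) g ∂P)) + reg * ‖g‖ ^ 2)
    hα0 hα1 hβ0 hβ1 hp0 hq0 hq1
    (div_nonneg (Finset.sum_nonneg fun i _ => he2 i) hn1.le)
    (div_nonneg (Finset.sum_nonneg fun i _ => he1 i) hn1.le)
    (fun D => ?_) (le_average_of_forall_le hU2) ?_ hUqC ?_ (by rw [hpe, hqe]; exact henergy)
    (by rw [hpe, hqe]; exact hobj)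
  · rw [← mul_assoc, ← mul_assoc q, hpn', hqm'] at hmain
    change ∫ z, (u z - r z.2) ^ 2 ∂(ν.prod P) ≤ _
    rw [hrisk]
    linarith
  · have h1 : ∀ i, (0 : ℝ) ≤ 1 * e2 i + (-(2 * D)) * e1 i + D ^ 2 := fun i => by
      linarith [hD D i]
    linarith [le_average_of_forall_le h1]
  · have h1 : ∀ i, ∫ z, |u z| ∂(ν.prod P) ≤ (1 + α) * e1 i + 0 * e1 i + β := fun i => by
      linarith [hU1 i]
    linarith [le_average_of_forall_le h1]
  · have h1 : ∀ i j, - ∫ z, u z ∂(ν.prod Q) ≤ (-1) * f1 j + 0 * f1 j + (α * e1 i + β) :=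
      fun i j => by linarith [hUq i j]
    have h2 : ∀ i, - ∫ z, u z ∂(ν.prod Q) ≤ α * e1 i + 0 * e1 i
        + (β - (∑ j, f1 j) / (m + 1)) := fun i => by
      linarith [le_average_of_forall_le (h1 i)]
    linarith [le_average_of_forall_le h2]

/-- Consistency of least-squares importance fitting in mean square, for a regularization parameter
that vanishes more slowly than the inverse sample sizes. -/
theorem tendsto_integral_sq_fit [CompleteSpace H]
    (hk : Continuous k) (hkb : ∀ x, ‖k x‖ ≤ κ) (hκ : 0 ≤ κ)
    (hr : Measurable r) (hr0 : ∀ x, 0 ≤ r x) (hrC : ∀ x, r x ≤ C) (hC : 0 ≤ C)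
    (hQ : Q = P.withDensity fun x => ENNReal.ofReal (r x))
    (happrox : ∀ ε > 0, ∃ g : H, ∫ x, (inner ℝ (k x) g - r x) ^ 2 ∂P ≤ ε)
    {reg : ℕ → ℕ → ℝ} (hreg : ∀ n m, 0 < reg n m)
    (hreg_zero : Tendsto (fun s : ℕ × ℕ => reg s.1 s.2) atTop (𝓝 0))
    (hreg_slow : Tendsto (fun s : ℕ × ℕ => reg s.1 s.2 * ((min s.1 s.2 : ℕ) : ℝ)) atTop atTop)
    {sol : (n m : ℕ) → (Fin n → X) → (Fin m → X) → H}
    (hsol : ∀ n m a b, NormalEq k (reg n m) (1 / n) (1 / m) a b (sol n m a b)) :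
    Tendsto (fun s : ℕ × ℕ =>
      ∫ z, (inner ℝ (k z.2) (sol s.1 s.2 z.1.1 z.1.2) - r z.2) ^ 2
        ∂(((Measure.pi fun _ : Fin s.1 => P).prod (Measure.pi fun _ : Fin s.2 => Q)).prod P))
      atTop (𝓝 0) := by
  obtain ⟨K, -, hK⟩ := exists_const_integral_sq_fit_le (P := P) (Q := Q) hk hkb hκ hr hr0 hrC hC hQ
  have hfst : Tendsto (fun s : ℕ × ℕ => 1 / (s.1 : ℝ)) atTop (𝓝 0) :=
    tendsto_one_div_atTop_nhds_zero_nat.comp (by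
      rw [← prod_atTop_atTop_eq]; exact tendsto_fst)
  have hsnd : Tendsto (fun s : ℕ × ℕ => 1 / (s.2 : ℝ)) atTop (𝓝 0) :=
    tendsto_one_div_atTop_nhds_zero_nat.comp (by
      rw [← prod_atTop_atTop_eq]; exact tendsto_snd)
  have hlim : Tendsto (fun s : ℕ × ℕ => κ ^ 2 * (reg s.1 s.2 * ((min s.1 s.2 : ℕ) : ℝ))⁻¹)
      atTop (𝓝 0) := by
    simpa using (tendsto_inv_atTop_zero.comp hreg_slow).const_mul (κ ^ 2)
  have hle : ∀ s : ℕ × ℕ, ∀ l : ℕ, 0 < s.1 → 0 < s.2 → min s.1 s.2 ≤ l →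
      κ ^ 2 / reg s.1 s.2 * (1 / (l : ℝ))
        ≤ κ ^ 2 * (reg s.1 s.2 * ((min s.1 s.2 : ℕ) : ℝ))⁻¹ := by
    intro s l h1 h2 h3
    have h4 : (0 : ℝ) < (min s.1 s.2 : ℕ) := by exact_mod_cast lt_min h1 h2
    have h5 : ((min s.1 s.2 : ℕ) : ℝ) ≤ l := by exact_mod_cast h3
    have h6 := hreg s.1 s.2
    have h7 : κ ^ 2 / reg s.1 s.2 * (1 / (l : ℝ)) = κ ^ 2 * (reg s.1 s.2 * l)⁻¹ := by
      rw [mul_inv, div_eq_mul_inv, one_div, mul_assoc]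
    rw [h7]
    gcongr
  have hpos : ∀ᶠ s : ℕ × ℕ in atTop, 0 < s.1 ∧ 0 < s.2 := by
    filter_upwards [eventually_ge_atTop ((1, 1) : ℕ × ℕ)] with s hs
    exact ⟨hs.1, hs.2⟩
  have hα : Tendsto (fun s : ℕ × ℕ => κ ^ 2 / reg s.1 s.2 * (1 / (s.1 : ℝ))) atTop (𝓝 0) :=
    tendsto_of_tendsto_of_tendsto_of_le_of_le' tendsto_const_nhds hlim
      (Eventually.of_forall fun s => by have := hreg s.1 s.2; positivity)
      (hpos.mono fun s hs => hle s _ hs.1 hs.2 (min_le_left _ _))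
  have hβ : Tendsto (fun s : ℕ × ℕ => κ ^ 2 / reg s.1 s.2 * (1 / (s.2 : ℝ))) atTop (𝓝 0) :=
    tendsto_of_tendsto_of_tendsto_of_le_of_le' tendsto_const_nhds hlim
      (Eventually.of_forall fun s => by have := hreg s.1 s.2; positivity)
      (hpos.mono fun s hs => hle s _ hs.1 hs.2 (min_le_right _ _))
  rw [Metric.tendsto_nhds]
  intro ε hε
  obtain ⟨g, hg⟩ := happrox (ε / 2) (by positivity)
  have hgrisk : ∫ x, (inner ℝ (k x) g - r x) ^ 2 ∂P = ∫ x, (inner ℝ (k x) g) ^ 2 ∂P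
      - 2 * ∫ x, r x * inner ℝ (k x) g ∂P + ∫ x, r x ^ 2 ∂P := by
    have hkgc : Continuous fun x => (inner ℝ (k x) g : ℝ) := hk.inner continuous_const
    have hkgb : ∀ x, |(inner ℝ (k x) g : ℝ)| ≤ κ * ‖g‖ := fun x => abs_inner_feature_le hkb x g
    have hI1 : Integrable (fun x => (inner ℝ (k x) g : ℝ) ^ 2) P :=
      integrable_of_continuous_of_bound (hkgc.pow 2) (B := (κ * ‖g‖) ^ 2) fun s => by
        rw [abs_pow]; exact pow_le_pow_left₀ (abs_nonneg _) (hkgb s) 2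
    have hI2 : Integrable (fun x => r x * (inner ℝ (k x) g : ℝ)) P := by
      refine Integrable.of_bound (hr.mul hkgc.measurable).aestronglyMeasurable
        (C * (κ * ‖g‖)) (ae_of_all _ fun z => ?_)
      rw [norm_mul, Real.norm_eq_abs, Real.norm_eq_abs, abs_of_nonneg (hr0 _)]
      exact mul_le_mul (hrC _) (hkgb _) (abs_nonneg _) hC
    have hI3 : Integrable (fun x => (r x) ^ 2) P := by
      refine Integrable.of_bound (hr.pow_const 2).aestronglyMeasurable
        (C ^ 2) (ae_of_all _ fun z => ?_)
      rw [norm_pow, Real.norm_eq_abs, abs_of_nonneg (hr0 _)]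
      exact pow_le_pow_left₀ (hr0 _) (hrC _) 2
    have hI4 : Integrable (fun x => (inner ℝ (k x) g : ℝ) ^ 2 - 2 * (r x * inner ℝ (k x) g)) P :=
      hI1.sub (hI2.const_mul 2)
    rw [← integral_const_mul, ← integral_sub hI1 (hI2.const_mul 2), ← integral_add hI4 hI3]
    exact integral_congr_ae (ae_of_all _ fun z => by simp only; ring)
  have hbound : Tendsto (fun s : ℕ × ℕ =>
      (1 + 1 / (s.1 : ℝ)) * ∫ x, (inner ℝ (k x) g) ^ 2 ∂P
        - 2 * ((1 + 1 / (s.2 : ℝ)) * ∫ x, r x * inner ℝ (k x) g ∂P) + reg s.1 s.2 * ‖g‖ ^ 2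
        + ∫ x, r x ^ 2 ∂P
        + K * (κ ^ 2 / reg s.1 s.2 * (1 / (s.1 : ℝ)) + κ ^ 2 / reg s.1 s.2 * (1 / (s.2 : ℝ))
          + 1 / (s.2 : ℝ))) atTop (𝓝 (∫ x, (inner ℝ (k x) g - r x) ^ 2 ∂P)) := by
    have h := (((((hfst.const_add 1).mul_const (∫ x, (inner ℝ (k x) g) ^ 2 ∂P)).sub
      (((hsnd.const_add 1).mul_const (∫ x, r x * inner ℝ (k x) g ∂P)).const_mul 2)).add
      (hreg_zero.mul_const (‖g‖ ^ 2))).add_const (∫ x, r x ^ 2 ∂P)).add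
      (((hα.add hβ).add hsnd).const_mul K)
    convert h using 2
    rw [hgrisk]
    ring
  have hlt := hbound.eventually_lt_const (show _ < ε by linarith)
  filter_upwards [hlt, hpos, hα.eventually_le_const one_pos, hβ.eventually_le_const one_pos]
    with s hs hs0 hsα hsβ
  have h := hK s.1 s.2 (reg s.1 s.2) hs0.1 hs0.2 (hreg _ _) hsα hsβ _ (hsol s.1 s.2) g
  rw [Real.dist_eq, sub_zero, abs_of_nonneg (integral_nonneg fun z => sq_nonneg _)]
  exact h.trans_lt hs

end Consistency

/-! ### Consistency of empirical risk minimization -/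

section Erm

/-- A map into a separable metric space is measurable if its distance to each point is. -/
lemma measurable_of_forall_measurable_dist {Z E : Type*} [MeasurableSpace Z]
    [PseudoMetricSpace E] [SecondCountableTopology E] [MeasurableSpace E] [BorelSpace E]
    {f : Z → E} (hf : ∀ g, Measurable fun z => dist (f z) g) : Measurable f := by
  refine measurable_of_isOpen fun U hU => ?_
  let ι := {p : E × ℝ // Metric.ball p.1 p.2 ⊆ U}
  obtain ⟨T, hT, hTU⟩ := TopologicalSpace.isOpen_iUnion_countable
    (fun p : ι => Metric.ball p.1.1 p.1.2) fun p => Metric.isOpen_ball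
  have hU' : U = ⋃ p ∈ T, Metric.ball p.1.1 p.1.2 := by
    rw [hTU]
    refine Set.Subset.antisymm (fun x hx => ?_) (Set.iUnion_subset fun p => p.2)
    obtain ⟨ε, hε, hball⟩ := Metric.isOpen_iff.1 hU x hx
    exact Set.mem_iUnion.2 ⟨⟨(x, ε), hball⟩, Metric.mem_ball_self hε⟩
  rw [hU', Set.preimage_iUnion₂]
  exact MeasurableSet.biUnion hT fun p _ => measurableSet_lt (hf p.1.1) measurable_const

lemma measurable_continuousMap_of_eval {Z W : Type*} [MeasurableSpace Z] [MetricSpace W]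
    [CompactSpace W] [MeasurableSpace C(W, ℝ)] [BorelSpace C(W, ℝ)] {f : Z → C(W, ℝ)}
    (hf : ∀ w, Measurable fun z => f z w) : Measurable f := by
  refine measurable_of_forall_measurable_dist fun g => measurable_of_Iic fun c => ?_
  obtain ⟨S, hSc, hSd⟩ := TopologicalSpace.exists_countable_dense W
  rcases lt_or_ge c 0 with hc | hc
  · convert MeasurableSet.empty
    ext z
    simpa using hc.trans_le dist_nonneg
  · have : (fun z => dist (f z) g) ⁻¹' Set.Iic c = ⋂ w ∈ S, {z | dist (f z w) (g w) ≤ c} := by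
      ext z
      simp only [Set.mem_preimage, Set.mem_Iic, Set.mem_iInter, Set.mem_ofPred_eq]
      rw [ContinuousMap.dist_le hc]
      refine ⟨fun h w _ => h w, fun h w => ?_⟩
      have hclosed : IsClosed {w | dist (f z w) (g w) ≤ c} :=
        isClosed_le ((f z).continuous.dist g.continuous) continuous_const
      have := hclosed.closure_subset_iff.2 (show S ⊆ _ from h)
      exact this (hSd w)
    rw [this]
    exact MeasurableSet.biInter hSc fun w _ =>
      measurableSet_le ((hf w).dist measurable_const) measurable_const

/-- Minimizers of a uniformly convergent sequence of continuous functions on a compact space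
converge to the minimizer of the limit, if this is unique. -/
lemma tendsto_minimizer {W : Type*} [TopologicalSpace W] [CompactSpace W]
    {f : ℕ → C(W, ℝ)} {g : C(W, ℝ)} (hfg : Tendsto f atTop (𝓝 g)) {w : ℕ → W}
    (hw : ∀ n v, f n (w n) ≤ f n v) {w₀ : W} (hw₀ : ∀ v, v ≠ w₀ → g w₀ < g v) :
    Tendsto w atTop (𝓝 w₀) := by
  rw [tendsto_nhds]
  intro U hU hwU
  rcases (Uᶜ).eq_empty_or_nonempty with hK | hK
  · rw [Set.compl_empty_iff] at hK
    simp [hK]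
  obtain ⟨v, hvK, hv⟩ := hU.isClosed_compl.isCompact.exists_isMinOn hK g.continuous.continuousOn
  have hlt : g w₀ < g v := hw₀ v fun h => hvK (h ▸ hwU)
  filter_upwards [Metric.tendsto_nhds.1 hfg ((g v - g w₀) / 2) (by linarith)] with n hn
  by_contra hnU
  have h1 : g v ≤ g (w n) := hv hnU
  have h2 := (abs_lt.1 ((ContinuousMap.dist_apply_le_dist (w n)).trans_lt hn)).1
  have h3 := (abs_lt.1 ((ContinuousMap.dist_apply_le_dist w₀).trans_lt hn)).2
  have h4 := hw n w₀
  linarith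

variable {Z W : Type*} [MeasurableSpace Z] {μ : Measure Z} [IsProbabilityMeasure μ]
  [MetricSpace W] [CompactSpace W] [MeasurableSpace W] [BorelSpace W]

/-- Consistency of empirical risk minimization over a compact parameter space: the strong law of
large numbers in the Banach space of continuous functions makes the empirical risk converge
uniformly. -/
theorem tendsto_integral_sq_loss_sub {ℓ : W → Z → ℝ} {M : ℝ}
    (hmeas : ∀ w, Measurable (ℓ w)) (hcont : ∀ z, Continuous fun w => ℓ w z)
    (hM : ∀ w z, |ℓ w z| ≤ M) {w₀ : W} (hw₀ : ∀ w, w ≠ w₀ → ∫ z, ℓ w₀ z ∂μ < ∫ z, ℓ w z ∂μ)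
    {what : (n : ℕ) → (Fin n → Z) → W} (hwhat_meas : ∀ n, Measurable (what n))
    (hwhat : ∀ n (D : Fin n → Z) w,
      (1 / (n : ℝ)) * ∑ i, ℓ (what n D) (D i) ≤ (1 / (n : ℝ)) * ∑ i, ℓ w (D i)) :
    Tendsto (fun n => ∫ p, (ℓ (what n p.1) p.2 - ℓ w₀ p.2) ^ 2
      ∂((Measure.pi fun _ : Fin n => μ).prod μ)) atTop (𝓝 0) := by
  borelize C(W, ℝ)
  have hjoint : Measurable (Function.uncurry ℓ) :=
    measurable_uncurry_of_continuous_of_measurable hcont hmeas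
  have hM0 : 0 ≤ M := by
    obtain ⟨z⟩ : Nonempty Z := μ.nonempty_of_neZero
    exact (abs_nonneg _).trans (hM w₀ z)
  let Φ : Z → C(W, ℝ) := fun z => ⟨fun w => ℓ w z, hcont z⟩
  have hΦ : Measurable Φ := measurable_continuousMap_of_eval hmeas
  have hΦn : ∀ z, ‖Φ z‖ ≤ M := fun z => (ContinuousMap.norm_le _ hM0).2 fun w => hM w z
  have hΦI : Integrable Φ μ :=
    Integrable.of_bound hΦ.aestronglyMeasurable M (ae_of_all _ hΦn)
  let ρ : Measure (ℕ → Z) := Measure.infinitePi fun _ => μ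
  have hev : ∀ i : ℕ, MeasurePreserving (fun x : ℕ → Z => x i) ρ μ := fun i =>
    measurePreserving_eval_infinitePi (fun _ => μ) i
  have hslln : ∀ᵐ x ∂ρ, Tendsto (fun n : ℕ => (n : ℝ)⁻¹ • ∑ i ∈ Finset.range n, Φ (x i))
      atTop (𝓝 (∫ z, Φ z ∂μ)) := by
    have h := strong_law_ae (μ := ρ) (fun i x => Φ (x i))
      ((hev 0).integrable_comp_of_integrable hΦI)
      (fun i j hij => (iIndepFun_infinitePi (P := fun _ : ℕ => μ) (X := fun _ => Φ)
        fun _ => hΦ).indepFun hij)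
      (fun i => ⟨(hΦ.comp (hev i).measurable).aemeasurable,
        (hΦ.comp (hev 0).measurable).aemeasurable, by
          rw [← Function.comp_def Φ, ← Function.comp_def Φ, ← Measure.map_map hΦ (hev i).measurable,
            ← Measure.map_map hΦ (hev 0).measurable, (hev i).map_eq, (hev 0).map_eq]⟩)
    have h2 : ∫ x, Φ (x 0) ∂ρ = ∫ z, Φ z ∂μ := by
      rw [← (hev 0).map_eq, integral_map (hev 0).measurable.aemeasurable]
      rw [(hev 0).map_eq]
      exact hΦ.aestronglyMeasurable
    rw [h2] at h
    exact h
  have hlimit : ∀ w, (∫ z, Φ z ∂μ) w = ∫ z, ℓ w z ∂μ := fun w =>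
    ContinuousMap.integral_apply hΦI w
  have hconv : ∀ᵐ x ∂ρ, Tendsto (fun n => what n fun i => x i) atTop (𝓝 w₀) := by
    filter_upwards [hslln] with x hx
    refine tendsto_minimizer hx (fun n v => ?_) fun v hv => ?_
    · have h := hwhat n (fun i => x i) v
      simp only [one_div] at h
      rw [Fin.sum_univ_eq_sum_range (fun i => ℓ (what n fun i => x i) (x i)),
        Fin.sum_univ_eq_sum_range (fun i => ℓ v (x i))] at h
      simpa [Φ, ContinuousMap.sum_apply] using h
    · rw [hlimit, hlimit]
      exact hw₀ v hv
  -- all sample sizes are realized on one infinite product space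
  have hrestr : ∀ n : ℕ, MeasurePreserving (fun (x : ℕ → Z) (i : Fin n) => x i) ρ
      (Measure.pi fun _ => μ) := fun n => by
    refine ⟨by fun_prop, ?_⟩
    rw [← Measure.infinitePi_eq_pi]
    exact Measure.map_infinitePi_infinitePi_of_inj (P := fun _ : ℕ => μ) Fin.val_injective
  have hFmeas : ∀ n, Measurable fun p : (Fin n → Z) × Z =>
      (ℓ (what n p.1) p.2 - ℓ w₀ p.2) ^ 2 := fun n =>
    ((hjoint.comp (((hwhat_meas n).comp measurable_fst).prodMk measurable_snd)).sub
      ((hmeas w₀).comp measurable_snd)).pow_const 2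
  have heq : ∀ n, ∫ p, (ℓ (what n p.1) p.2 - ℓ w₀ p.2) ^ 2
      ∂((Measure.pi fun _ : Fin n => μ).prod μ)
      = ∫ p, (ℓ (what n fun i => p.1 i) p.2 - ℓ w₀ p.2) ^ 2 ∂(ρ.prod μ) := fun n =>
    (integral_comp_of_measurePreserving ((hrestr n).prod (MeasurePreserving.id μ))
      (hFmeas n).aestronglyMeasurable).symm
  simp_rw [heq]
  have hzero : ∫ _p, (0 : ℝ) ∂(ρ.prod μ) = 0 := by simp
  rw [← hzero]
  refine tendsto_integral_of_dominated_convergence (fun _ => (2 * M) ^ 2) (fun n => ?_)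
    (integrable_const _) (fun n => ae_of_all _ fun p => ?_) ?_
  · exact ((hFmeas n).comp
      ((hrestr n).prod (MeasurePreserving.id μ)).measurable).aestronglyMeasurable
  · rw [norm_pow, Real.norm_eq_abs]
    refine pow_le_pow_left₀ (abs_nonneg _) ?_ 2
    calc _ ≤ |ℓ (what n fun i => p.1 i) p.2| + |ℓ w₀ p.2| := abs_sub _ _
      _ ≤ 2 * M := by linarith [hM (what n fun i => p.1 i) p.2, hM w₀ p.2]
  · filter_upwards [Measure.quasiMeasurePreserving_fst.ae hconv] with p hp
    have h := ((((hcont p.2).tendsto w₀).comp hp).sub_const (ℓ w₀ p.2)).pow 2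
    simpa using h

end Erm

/-! ### Change of measure under covariate shift -/

section CovariateShift

variable {𝒳 𝒴 : Type*} [MeasureSpace 𝒳] [MeasureSpace 𝒴] {p pT pS : 𝒳 × 𝒴 → ℝ}

lemma IsJointDensity.isProbabilityMeasure_jointLaw (hp : IsJointDensity p) :
    IsProbabilityMeasure (jointLaw p) :=
  ⟨by rw [jointLaw, withDensity_apply _ MeasurableSet.univ, Measure.restrict_univ,
    hp.lintegral_eq_one]⟩

lemma IsJointDensity.isProbabilityMeasure_featureLaw (hp : IsJointDensity p) :
    IsProbabilityMeasure (featureLaw p) :=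
  have := hp.isProbabilityMeasure_jointLaw
  Measure.isProbabilityMeasure_map measurable_fst.aemeasurable

lemma IsJointDensity.featureDensity_nonneg (hp : IsJointDensity p) (x : 𝒳) :
    0 ≤ featureDensity p x :=
  integral_nonneg fun y => hp.nonneg (x, y)

lemma IsJointDensity.integrable (hp : IsJointDensity p) : Integrable p := by
  refine ⟨hp.measurable.aestronglyMeasurable, ?_⟩
  rw [hasFiniteIntegral_iff_ofReal (ae_of_all _ hp.nonneg), hp.lintegral_eq_one]
  exact ENNReal.one_lt_top

lemma densityRatio_nonneg (hpT : IsJointDensity pT) (hpS : IsJointDensity pS) (x : 𝒳) :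
    0 ≤ densityRatio pT pS x :=
  div_nonneg (hpT.featureDensity_nonneg x) (hpS.featureDensity_nonneg x)

variable [SFinite (volume : Measure 𝒴)]

lemma IsJointDensity.measurable_featureDensity (hp : IsJointDensity p) :
    Measurable (featureDensity p) :=
  (hp.measurable.stronglyMeasurable.integral_prod_right').measurable

lemma measurable_densityRatio (hpT : IsJointDensity pT) (hpS : IsJointDensity pS) :
    Measurable (densityRatio pT pS) :=
  hpT.measurable_featureDensity.div hpS.measurable_featureDensity

variable [SFinite (volume : Measure 𝒳)]

/-- A joint density vanishes almost everywhere over the zeros of its feature marginal. -/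
lemma IsJointDensity.ae_eq_zero (hp : IsJointDensity p) :
    ∀ᵐ z : 𝒳 × 𝒴, featureDensity p z.1 = 0 → p z = 0 := by
  have hms : MeasurableSet {z : 𝒳 × 𝒴 | featureDensity p z.1 = 0 → p z = 0} := by
    have h1 : MeasurableSet {z : 𝒳 × 𝒴 | featureDensity p z.1 = 0} :=
      (hp.measurable_featureDensity.comp measurable_fst) (measurableSet_singleton 0)
    have h2 : MeasurableSet {z : 𝒳 × 𝒴 | p z = 0} := hp.measurable (measurableSet_singleton 0)
    exact h1.imp h2
  rw [Measure.volume_eq_prod, Measure.ae_prod_iff_ae_ae hms]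
  have hI := hp.integrable
  rw [Measure.volume_eq_prod] at hI
  filter_upwards [hI.prod_right_ae] with x hx
  by_cases h0 : featureDensity p x = 0
  · filter_upwards [(integral_eq_zero_iff_of_nonneg (fun y => hp.nonneg (x, y)) hx).1 h0]
      with y hy _ using hy
  · exact ae_of_all _ fun y h => absurd h h0

/-- Under covariate shift, the target density is the source density times the density ratio of
the features. -/
lemma ae_eq_densityRatio_mul (hpT : IsJointDensity pT)
    (hsupp : SourceCoversTarget pT pS) (hcond : SameConditional pT pS) :
    ∀ᵐ z : 𝒳 × 𝒴, pT z = pS z * densityRatio pT pS z.1 := by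
  have hsupp' : ∀ᵐ z : 𝒳 × 𝒴, 0 < featureDensity pT z.1 → 0 < featureDensity pS z.1 := by
    rw [Measure.volume_eq_prod]
    exact Measure.quasiMeasurePreserving_fst.ae hsupp
  filter_upwards [hsupp', hcond, hpT.ae_eq_zero] with z hz1 hz2 hz3
  rcases (hpT.featureDensity_nonneg z.1).eq_or_lt with h0 | h0
  · rw [hz3 h0.symm, densityRatio, ← h0, zero_div, mul_zero]
  · have h1 := hz1 h0
    have h2 := hz2 h0
    rw [condDensity, condDensity, div_eq_div_iff h0.ne' h1.ne'] at h2
    rw [densityRatio, mul_div_assoc', eq_div_iff h1.ne', h2]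

lemma jointLaw_eq_withDensity (hpT : IsJointDensity pT) (hpS : IsJointDensity pS)
    (hsupp : SourceCoversTarget pT pS) (hcond : SameConditional pT pS) :
    jointLaw pT = (jointLaw pS).withDensity
      fun z => ENNReal.ofReal (densityRatio pT pS z.1) := by
  have hm : Measurable fun z : 𝒳 × 𝒴 => ENNReal.ofReal (densityRatio pT pS z.1) :=
    ((measurable_densityRatio hpT hpS).comp measurable_fst).ennreal_ofReal
  rw [jointLaw, jointLaw, ← withDensity_mul _ hpS.measurable.ennreal_ofReal hm]
  refine withDensity_congr_ae ?_
  filter_upwards [ae_eq_densityRatio_mul hpT hsupp hcond] with z hz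
  rw [Pi.mul_apply, ← ENNReal.ofReal_mul (hpS.nonneg z), hz]

lemma featureLaw_eq_withDensity (hpT : IsJointDensity pT) (hpS : IsJointDensity pS)
    (hsupp : SourceCoversTarget pT pS) (hcond : SameConditional pT pS) :
    featureLaw pT = (featureLaw pS).withDensity
      fun x => ENNReal.ofReal (densityRatio pT pS x) := by
  have hm : Measurable fun x : 𝒳 => ENNReal.ofReal (densityRatio pT pS x) :=
    (measurable_densityRatio hpT hpS).ennreal_ofReal
  ext s hs
  rw [featureLaw, Measure.map_apply measurable_fst hs, withDensity_apply _ hs,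
    jointLaw_eq_withDensity hpT hpS hsupp hcond, withDensity_apply _ (measurable_fst hs),
    featureLaw, setLIntegral_map hs hm measurable_fst]

end CovariateShift

/-! ### Moments of the importance-weighted estimate -/

section Moments

/-- Mean square convergence to variables with fixed mean and variance entails convergence of the
means and variances. -/
lemma tendsto_integral_and_variance {ι : Type*} {l : Filter ι} {Ω : ι → Type*}
    [∀ i, MeasurableSpace (Ω i)] {μ : ∀ i, Measure (Ω i)} [∀ i, IsProbabilityMeasure (μ i)]
    {f g : ∀ i, Ω i → ℝ} {G e v : ℝ} (hf : ∀ i, MemLp (f i) 2 (μ i))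
    (hg : ∀ i, MemLp (g i) 2 (μ i)) (hG : ∀ i x, |g i x| ≤ G)
    (hfg : Tendsto (fun i => ∫ x, (f i x - g i x) ^ 2 ∂(μ i)) l (𝓝 0))
    (he : ∀ i, ∫ x, g i x ∂(μ i) = e) (hv : ∀ i, variance (g i) (μ i) = v) :
    Tendsto (fun i => ∫ x, f i x ∂(μ i)) l (𝓝 e) ∧
    Tendsto (fun i => variance (f i) (μ i)) l (𝓝 v) := by
  have hd : ∀ i, MemLp (fun x => f i x - g i x) 2 (μ i) := fun i => (hf i).sub (hg i)
  have hdI : ∀ i, Integrable (fun x => f i x - g i x) (μ i) := fun i =>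
    (hd i).integrable one_le_two
  have habs : Tendsto (fun i => ∫ x, |f i x - g i x| ∂(μ i)) l (𝓝 0) := by
    have h1 : ∀ i, ∫ x, |f i x - g i x| ∂(μ i) ≤ √(∫ x, (f i x - g i x) ^ 2 ∂(μ i)) := by
      intro i
      refine Real.le_sqrt_of_sq_le ?_
      have h2 := variance_nonneg (fun x => |f i x - g i x|) (μ i)
      have h3 : MemLp (fun x => |f i x - g i x|) 2 (μ i) := (hd i).abs
      rw [variance_eq_sub h3] at h2
      simp only [Pi.pow_apply, sq_abs] at h2
      linarith
    have h3 := (Real.continuous_sqrt.tendsto 0).comp hfg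
    rw [Real.sqrt_zero] at h3
    exact squeeze_zero (fun i => integral_nonneg fun x => abs_nonneg _) h1 h3
  have hmean : Tendsto (fun i => ∫ x, f i x ∂(μ i)) l (𝓝 e) := by
    have h1 : ∀ i, |∫ x, f i x ∂(μ i) - e| ≤ ∫ x, |f i x - g i x| ∂(μ i) := by
      intro i
      rw [← he i, ← integral_sub ((hf i).integrable one_le_two) ((hg i).integrable one_le_two)]
      exact abs_integral_le_integral_abs
    rw [tendsto_iff_norm_sub_tendsto_zero]
    exact squeeze_zero (fun i => norm_nonneg _) h1 habs
  refine ⟨hmean, ?_⟩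
  have hcross : Tendsto (fun i => ∫ x, g i x * (f i x - g i x) ∂(μ i)) l (𝓝 0) := by
    have h1 : ∀ i, ‖∫ x, g i x * (f i x - g i x) ∂(μ i)‖ ≤ G * ∫ x, |f i x - g i x| ∂(μ i) := by
      intro i
      rw [← integral_const_mul]
      refine norm_integral_le_of_norm_le ((hdI i).abs.const_mul G) (ae_of_all _ fun x => ?_)
      rw [norm_mul, Real.norm_eq_abs, Real.norm_eq_abs]
      exact mul_le_mul_of_nonneg_right (hG i x) (abs_nonneg _)
    exact squeeze_zero_norm h1 (by simpa using habs.const_mul G)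
  have hsq : ∀ i, variance (f i) (μ i) = (v + e ^ 2) + 2 * ∫ x, g i x * (f i x - g i x) ∂(μ i)
      + ∫ x, (f i x - g i x) ^ 2 ∂(μ i) - (∫ x, f i x ∂(μ i)) ^ 2 := by
    intro i
    have h1 : v + e ^ 2 = ∫ x, (g i x) ^ 2 ∂(μ i) := by
      rw [← hv i, ← he i, variance_eq_sub (hg i)]
      simp
    have hgd : Integrable (fun x => g i x * (f i x - g i x)) (μ i) := (hg i).integrable_mul (hd i)
    have hI : Integrable (fun x => (g i x) ^ 2 + 2 * (g i x * (f i x - g i x))) (μ i) :=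
      (hg i).integrable_sq.add (hgd.const_mul 2)
    rw [variance_eq_sub (hf i), h1, ← integral_const_mul,
      ← integral_add (hg i).integrable_sq (hgd.const_mul 2),
      ← integral_add hI (hd i).integrable_sq]
    congr 1
    exact integral_congr_ae (ae_of_all _ fun x => by simp only [Pi.pow_apply]; ring)
  simp_rw [hsq]
  have h := (((hcross.const_mul 2).const_add (v + e ^ 2)).add hfg).sub (hmean.pow 2)
  convert h using 2
  ring

/-- Mean and variance of the average of a function over an i.i.d. sample. -/
lemma integral_and_variance_sampleMean {Z : Type*} [MeasurableSpace Z] {J : Measure Z}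
    [IsProbabilityMeasure J] {φ : Z → ℝ} (hφ : MemLp φ 2 J) {n : ℕ} (hn : 0 < n) :
    ∫ V, (1 / (n : ℝ)) * ∑ i, φ (V i) ∂(Measure.pi fun _ : Fin n => J) = ∫ z, φ z ∂J ∧
    variance (fun V : Fin n → Z => (1 / (n : ℝ)) * ∑ i, φ (V i)) (Measure.pi fun _ => J)
      = (1 / (n : ℝ)) * (∫ z, φ z ^ 2 ∂J - (∫ z, φ z ∂J) ^ 2) := by
  have hn' : (n : ℝ) ≠ 0 := by exact_mod_cast hn.ne'
  have hev : ∀ i : Fin n, MeasurePreserving (fun V : Fin n → Z => V i)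
      (Measure.pi fun _ => J) J := fun i => measurePreserving_eval (fun _ => J) i
  have hI := hφ.integrable one_le_two
  constructor
  · have hIi : ∀ i : Fin n, Integrable (fun V : Fin n → Z => φ (V i)) (Measure.pi fun _ => J) :=
      fun i => (hev i).integrable_comp_of_integrable hI
    rw [integral_const_mul, integral_finsetSum _ fun i _ => hIi i]
    simp_rw [fun i => integral_comp_of_measurePreserving (hev i) hI.aestronglyMeasurable]
    simp only [Finset.sum_const, Finset.card_univ, Fintype.card_fin, nsmul_eq_mul]
    field_simp
  · have h := variance_sum_pi (μ := fun _ : Fin n => J) (X := fun _ => φ) fun _ => hφ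
    have h2 : (∑ i : Fin n, fun V : Fin n → Z => φ (V i)) = fun V => ∑ i, φ (V i) := by
      ext V
      simp
    rw [h2] at h
    rw [variance_const_mul, h, variance_eq_sub hφ]
    simp only [Finset.sum_const, Finset.card_univ, Fintype.card_fin, nsmul_eq_mul, Pi.pow_apply]
    field_simp

variable {X Y W : Type*} [MeasurableSpace X] [MeasurableSpace Y] [MeasurableSpace W]
  {J : Measure (X × Y)} {Q : Measure X} [IsProbabilityMeasure J] [IsProbabilityMeasure Q]

/-- The importance-weighted average over the validation sample has the same limits of mean and
variance as with the true weights and the optimal parameter, if the estimated weights and the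
loss at the estimated parameter converge in mean square. -/
theorem limits_of_mean_square_convergence {P : Measure X} (hP : P = J.map Prod.fst)
    {r : X → ℝ} {C M : ℝ} (hr : Measurable r) (hr0 : ∀ x, 0 ≤ r x) (hrC : ∀ x, r x ≤ C)
    {ℓ : W → X × Y → ℝ} (hℓ : Measurable (Function.uncurry ℓ)) (hM : ∀ w z, |ℓ w z| ≤ M) {w₀ : W}
    {what : (n : ℕ) → (Fin n → X × Y) → W} (hwhat : ∀ n, Measurable (what n))
    {rhat : (n m : ℕ) → ((Fin n → X) × (Fin m → X)) × X → ℝ}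
    (hrhat : ∀ n m, Measurable (rhat n m)) (hrhatb : ∀ n m, ∃ B, ∀ z, |rhat n m z| ≤ B)
    (hrlim : Tendsto (fun s : ℕ × ℕ => ∫ z, (rhat s.1 s.2 z - r z.2) ^ 2
      ∂(((Measure.pi fun _ : Fin s.1 => P).prod (Measure.pi fun _ : Fin s.2 => Q)).prod P))
      atTop (𝓝 0))
    (hwlim : Tendsto (fun n => ∫ p, (ℓ (what n p.1) p.2 - ℓ w₀ p.2) ^ 2
      ∂((Measure.pi fun _ : Fin n => J).prod J)) atTop (𝓝 0))
    {nval : ℕ} (hnval : 0 < nval)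
    (F : (n t m : ℕ) →
      (Fin n → X × Y) × (Fin t → X × Y) × (Fin nval → X × Y) × (Fin m → X) → ℝ)
    (hF : F = fun n t m D => (1 / (nval : ℝ)) * ∑ i,
      rhat n m ((fun i => (D.1 i).1, D.2.2.2), (D.2.2.1 i).1) * ℓ (what t D.2.1) (D.2.2.1 i))
    (law : (n t m : ℕ) → Measure
      ((Fin n → X × Y) × (Fin t → X × Y) × (Fin nval → X × Y) × (Fin m → X)))
    (hlaw : law = fun _ _ _ => (Measure.pi fun _ => J).prod
      ((Measure.pi fun _ => J).prod ((Measure.pi fun _ => J).prod (Measure.pi fun _ => Q)))) :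
    (∀ n t m, MemLp (F n t m) 2 (law n t m)) ∧
    Tendsto (fun s : ℕ × ℕ × ℕ => ∫ D, F s.1 s.2.1 s.2.2 D ∂(law s.1 s.2.1 s.2.2)) atTop
      (𝓝 (∫ z, r z.1 * ℓ w₀ z ∂J)) ∧
    Tendsto (fun s : ℕ × ℕ × ℕ => variance (F s.1 s.2.1 s.2.2) (law s.1 s.2.1 s.2.2)) atTop
      (𝓝 ((1 / (nval : ℝ)) *
        (∫ z, (r z.1 * ℓ w₀ z) ^ 2 ∂J - (∫ z, r z.1 * ℓ w₀ z ∂J) ^ 2))) := by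
  have hPprob : IsProbabilityMeasure P := by
    rw [hP]
    exact Measure.isProbabilityMeasure_map measurable_fst.aemeasurable
  have hlawprob : ∀ n t m, IsProbabilityMeasure (law n t m) := by
    rw [hlaw]
    intro n t m
    infer_instance
  have hfst : MeasurePreserving (Prod.fst : X × Y → X) J P := ⟨measurable_fst, hP.symm⟩
  obtain ⟨z₀⟩ : Nonempty (X × Y) := J.nonempty_of_neZero
  have hM0 : 0 ≤ M := (abs_nonneg _).trans (hM w₀ z₀)
  have hC0 : 0 ≤ C := (hr0 z₀.1).trans (hrC z₀.1)
  have hn' : (0 : ℝ) < nval := by exact_mod_cast hnval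
  have hℓw : ∀ w, Measurable (ℓ w) := fun w => hℓ.comp measurable_prodMk_left
  have hra : ∀ x, |r x| ≤ C := fun x => by rw [abs_of_nonneg (hr0 x)]; exact hrC x
  -- the oracle summand
  let φ : X × Y → ℝ := fun z => r z.1 * ℓ w₀ z
  have hφ : Measurable φ := (hr.comp measurable_fst).mul (hℓw w₀)
  have hφb : ∀ z, |φ z| ≤ C * M := fun z => by
    rw [abs_mul]
    exact mul_le_mul (hra _) (hM _ _) (abs_nonneg _) hC0
  have hφL : MemLp φ 2 J := MemLp.of_bound hφ.aestronglyMeasurable (C * M) (ae_of_all _ hφb)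
  let g : (Fin nval → X × Y) → ℝ := fun V => (1 / (nval : ℝ)) * ∑ i, φ (V i)
  have hgm : Measurable g := by
    refine measurable_const.mul (Finset.measurable_fun_sum _ fun i _ => ?_)
    exact hφ.comp (measurable_pi_apply i)
  have hmeanb : ∀ (f : Fin nval → ℝ) (B : ℝ), (∀ i, |f i| ≤ B) →
      |(1 / (nval : ℝ)) * ∑ i, f i| ≤ B := by
    intro f B hf
    rw [abs_mul, abs_of_nonneg (by positivity : 0 ≤ 1 / (nval : ℝ))]
    calc 1 / (nval : ℝ) * |∑ i, f i| ≤ 1 / (nval : ℝ) * (nval * B) := by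
          gcongr
          refine (Finset.abs_sum_le_sum_abs _ _).trans
            ((Finset.sum_le_sum fun i _ => hf i).trans ?_)
          simp
      _ = B := by field_simp
  have hgb : ∀ V, |g V| ≤ C * M := fun V => hmeanb _ _ fun i => hφb _
  have hval : ∀ n t m, MeasurePreserving
      (fun D : (Fin n → X × Y) × (Fin t → X × Y) × (Fin nval → X × Y) × (Fin m → X) => D.2.2.1)
      (law n t m) (Measure.pi fun _ => J) := fun n t m => by
    rw [hlaw]
    exact (measurePreserving_fst.comp measurePreserving_snd).comp measurePreserving_snd
  -- a validation point together with the training sample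
  have hmp1 : ∀ n t m (i : Fin nval), MeasurePreserving
      (fun D : (Fin n → X × Y) × (Fin t → X × Y) × (Fin nval → X × Y) × (Fin m → X) =>
        (D.2.1, D.2.2.1 i))
      (law n t m) ((Measure.pi fun _ => J).prod J) := fun n t m i => by
    rw [hlaw]
    have h1 : MeasurePreserving (fun p : (Fin nval → X × Y) × (Fin m → X) => p.1 i)
        ((Measure.pi fun _ => J).prod (Measure.pi fun _ => Q)) J :=
      (measurePreserving_eval (fun _ => J) i).comp measurePreserving_fst
    exact ((MeasurePreserving.id _).prod h1).comp measurePreserving_snd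
  -- a validation feature together with the two samples of the importance fit
  have hmp2 : ∀ n t m (i : Fin nval), MeasurePreserving
      (fun D : (Fin n → X × Y) × (Fin t → X × Y) × (Fin nval → X × Y) × (Fin m → X) =>
        (((fun l => (D.1 l).1 : Fin n → X), D.2.2.2), (D.2.2.1 i).1))
      (law n t m)
      (((Measure.pi fun _ => P).prod (Measure.pi fun _ => Q)).prod P) := fun n t m i => by
    rw [hlaw]
    have h0 : MeasurePreserving (fun (a : Fin n → X × Y) l => (a l).1)
        (Measure.pi fun _ => J) (Measure.pi fun _ => P) :=
      measurePreserving_pi _ _ fun _ => hfst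
    have h1 : MeasurePreserving (fun V : Fin nval → X × Y => (V i).1)
        (Measure.pi fun _ => J) P := hfst.comp (measurePreserving_eval (fun _ => J) i)
    have h2 : MeasurePreserving
        (fun p : (Fin t → X × Y) × (Fin nval → X × Y) × (Fin m → X) => (p.2.2, (p.2.1 i).1))
        ((Measure.pi fun _ => J).prod ((Measure.pi fun _ => J).prod (Measure.pi fun _ => Q)))
        ((Measure.pi fun _ => Q).prod P) :=
      (Measure.measurePreserving_swap.comp (h1.prod (MeasurePreserving.id _))).comp
        measurePreserving_snd
    exact (measurePreserving_prodAssoc _ _ _).symm.comp (h0.prod h2)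
  have hA : ∀ n t m (i : Fin nval), Measurable
      (fun D : (Fin n → X × Y) × (Fin t → X × Y) × (Fin nval → X × Y) × (Fin m → X) =>
        rhat n m ((fun l => (D.1 l).1, D.2.2.2), (D.2.2.1 i).1)) := fun n t m i =>
    (hrhat n m).comp (hmp2 n t m i).measurable
  have hB : ∀ n t m (i : Fin nval), Measurable
      (fun D : (Fin n → X × Y) × (Fin t → X × Y) × (Fin nval → X × Y) × (Fin m → X) =>
        ℓ (what t D.2.1) (D.2.2.1 i)) := fun n t m i => by
    have h : Measurable fun p : (Fin t → X × Y) × (X × Y) => ℓ (what t p.1) p.2 :=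
      hℓ.comp (((hwhat t).comp measurable_fst).prodMk measurable_snd)
    exact h.comp (hmp1 n t m i).measurable
  have hFL : ∀ n t m, MemLp (F n t m) 2 (law n t m) := by
    intro n t m
    obtain ⟨B, hB'⟩ := hrhatb n m
    have hFm : Measurable (F n t m) := by
      rw [hF]
      exact measurable_const.mul (Finset.measurable_fun_sum _ fun i _ =>
        (hA n t m i).mul (hB n t m i))
    refine MemLp.of_bound hFm.aestronglyMeasurable (B * M) (ae_of_all _ fun D => ?_)
    rw [hF]
    refine hmeanb _ _ fun i => ?_
    rw [abs_mul]
    exact mul_le_mul (hB' _) (hM _ _) (abs_nonneg _) 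
      ((abs_nonneg _).trans (hB' ((fun l => (D.1 l).1, D.2.2.2), (D.2.2.1 i).1)))
  refine ⟨hFL, ?_⟩
  have hgL : ∀ n t m, MemLp (fun D => g (Prod.fst (Prod.snd (Prod.snd D)))) 2 (law n t m) :=
    fun n t m => MemLp.of_bound (hgm.comp (hval n t m).measurable).aestronglyMeasurable (C * M)
      (ae_of_all _ fun D => hgb _)
  have hmv := integral_and_variance_sampleMean hφL hnval
  refine tendsto_integral_and_variance (fun s => hFL s.1 s.2.1 s.2.2)
    (fun s => hgL s.1 s.2.1 s.2.2) (fun s D => hgb _) ?_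
    (fun s => ?_) (fun s => ?_)
  -- the squared distance to the oracle average splits into the two mean square errors
  · have hbound : ∀ n t m, ∫ D, (F n t m D - g D.2.2.1) ^ 2 ∂(law n t m) ≤
        2 * M ^ 2 * ∫ z, (rhat n m z - r z.2) ^ 2
          ∂(((Measure.pi fun _ : Fin n => P).prod (Measure.pi fun _ : Fin m => Q)).prod P)
        + 2 * C ^ 2 * ∫ p, (ℓ (what t p.1) p.2 - ℓ w₀ p.2) ^ 2
          ∂((Measure.pi fun _ : Fin t => J).prod J) := by
      intro n t m
      obtain ⟨B, hB'⟩ := hrhatb n m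
      have hUm : Measurable fun z : ((Fin n → X) × (Fin m → X)) × X =>
          (rhat n m z - r z.2) ^ 2 :=
        ((hrhat n m).sub (hr.comp measurable_snd)).pow_const 2
      have hVm : Measurable fun p : (Fin t → X × Y) × (X × Y) =>
          (ℓ (what t p.1) p.2 - ℓ w₀ p.2) ^ 2 :=
        ((hℓ.comp (((hwhat t).comp measurable_fst).prodMk measurable_snd)).sub
          ((hℓw w₀).comp measurable_snd)).pow_const 2
      have hUI : Integrable (fun z : ((Fin n → X) × (Fin m → X)) × X =>
          (rhat n m z - r z.2) ^ 2)
          (((Measure.pi fun _ : Fin n => P).prod (Measure.pi fun _ : Fin m => Q)).prod P) := by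
        refine Integrable.of_bound hUm.aestronglyMeasurable ((B + C) ^ 2) (ae_of_all _ fun z => ?_)
        rw [norm_pow, Real.norm_eq_abs]
        exact pow_le_pow_left₀ (abs_nonneg _)
          ((abs_sub _ _).trans (add_le_add (hB' _) (hra _))) 2
      have hVI : Integrable (fun p : (Fin t → X × Y) × (X × Y) =>
          (ℓ (what t p.1) p.2 - ℓ w₀ p.2) ^ 2) ((Measure.pi fun _ : Fin t => J).prod J) := by
        refine Integrable.of_bound hVm.aestronglyMeasurable ((M + M) ^ 2) (ae_of_all _ fun z => ?_)
        rw [norm_pow, Real.norm_eq_abs]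
        exact pow_le_pow_left₀ (abs_nonneg _)
          ((abs_sub _ _).trans (add_le_add (hM _ _) (hM _ _))) 2
      let U : Fin nval → (Fin n → X × Y) × (Fin t → X × Y) × (Fin nval → X × Y) × (Fin m → X) → ℝ :=
        fun i D => (rhat n m ((fun l => (D.1 l).1, D.2.2.2), (D.2.2.1 i).1) - r (D.2.2.1 i).1) ^ 2
      let V : Fin nval → (Fin n → X × Y) × (Fin t → X × Y) × (Fin nval → X × Y) × (Fin m → X) → ℝ :=
        fun i D => (ℓ (what t D.2.1) (D.2.2.1 i) - ℓ w₀ (D.2.2.1 i)) ^ 2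
      have hU : ∀ i, Integrable (U i) (law n t m) ∧ ∫ D, U i D ∂(law n t m) =
          ∫ z, (rhat n m z - r z.2) ^ 2
          ∂(((Measure.pi fun _ : Fin n => P).prod (Measure.pi fun _ : Fin m => Q)).prod P) :=
        fun i => ⟨(hmp2 n t m i).integrable_comp_of_integrable hUI,
          integral_comp_of_measurePreserving (hmp2 n t m i) hUI.aestronglyMeasurable⟩
      have hV : ∀ i, Integrable (V i) (law n t m) ∧ ∫ D, V i D ∂(law n t m) =
          ∫ p, (ℓ (what t p.1) p.2 - ℓ w₀ p.2) ^ 2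
          ∂((Measure.pi fun _ : Fin t => J).prod J) :=
        fun i => ⟨(hmp1 n t m i).integrable_comp_of_integrable hVI,
          integral_comp_of_measurePreserving (hmp1 n t m i) hVI.aestronglyMeasurable⟩
      have hUV : ∀ i, Integrable (fun D => 2 * M ^ 2 * U i D + 2 * C ^ 2 * V i D) (law n t m) :=
        fun i => ((hU i).1.const_mul _).add ((hV i).1.const_mul _)
      have hsum : ∫ D, (1 / (nval : ℝ)) * ∑ i, (2 * M ^ 2 * U i D + 2 * C ^ 2 * V i D) ∂(law n t m)
          = 2 * M ^ 2 * ∫ z, (rhat n m z - r z.2) ^ 2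
          ∂(((Measure.pi fun _ : Fin n => P).prod (Measure.pi fun _ : Fin m => Q)).prod P)
        + 2 * C ^ 2 * ∫ p, (ℓ (what t p.1) p.2 - ℓ w₀ p.2) ^ 2
          ∂((Measure.pi fun _ : Fin t => J).prod J) := by
        rw [integral_const_mul, integral_finsetSum _ fun i _ => hUV i]
        simp_rw [fun i => integral_add ((hU i).1.const_mul (2 * M ^ 2))
          ((hV i).1.const_mul (2 * C ^ 2)), integral_const_mul, fun i => (hU i).2,
          fun i => (hV i).2]
        simp only [Finset.sum_const, Finset.card_univ, Fintype.card_fin, nsmul_eq_mul]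
        field_simp
      rw [← hsum]
      refine integral_mono ((hFL n t m).sub (hgL n t m)).integrable_sq
        ((integrable_finsetSum _ fun i _ => hUV i).const_mul _) fun D => ?_
      have hdiff : F n t m D - g D.2.2.1 = (1 / (nval : ℝ)) * ∑ i,
          (rhat n m ((fun l => (D.1 l).1, D.2.2.2), (D.2.2.1 i).1) * ℓ (what t D.2.1) (D.2.2.1 i)
            - r (D.2.2.1 i).1 * ℓ w₀ (D.2.2.1 i)) := by
        rw [hF, Finset.sum_sub_distrib, mul_sub]
      have hcs := sq_sum_le_card_mul_sum_sq (s := (Finset.univ : Finset (Fin nval))) (f := fun i =>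
          (rhat n m ((fun l => (D.1 l).1, D.2.2.2), (D.2.2.1 i).1) * ℓ (what t D.2.1) (D.2.2.1 i)
            - r (D.2.2.1 i).1 * ℓ w₀ (D.2.2.1 i)))
      rw [Finset.card_univ, Fintype.card_fin] at hcs
      calc (F n t m D - g D.2.2.1) ^ 2
          ≤ (1 / (nval : ℝ)) * ∑ i, (rhat n m ((fun l => (D.1 l).1, D.2.2.2), (D.2.2.1 i).1)
              * ℓ (what t D.2.1) (D.2.2.1 i) - r (D.2.2.1 i).1 * ℓ w₀ (D.2.2.1 i)) ^ 2 := by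
            rw [hdiff, mul_pow]
            refine (mul_le_mul_of_nonneg_left hcs (by positivity)).trans (le_of_eq ?_)
            rw [← mul_assoc]
            congr 1
            field_simp
        _ ≤ (1 / (nval : ℝ)) * ∑ i, (2 * M ^ 2 * U i D + 2 * C ^ 2 * V i D) := by
            refine mul_le_mul_of_nonneg_left (Finset.sum_le_sum fun i _ => ?_) (by positivity)
            simp only [U, V]
            generalize rhat n m ((fun l => (D.1 l).1, D.2.2.2), (D.2.2.1 i).1) = ρ
            have h1 := hM (what t D.2.1) (D.2.2.1 i)
            have h2 := hra (D.2.2.1 i).1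
            generalize ℓ (what t D.2.1) (D.2.2.1 i) = a at *
            generalize r (D.2.2.1 i).1 = b at *
            generalize ℓ w₀ (D.2.2.1 i) = c at *
            have h3 : a ^ 2 ≤ M ^ 2 := sq_le_sq' (abs_le.1 h1).1 (abs_le.1 h1).2
            have h4 : b ^ 2 ≤ C ^ 2 := sq_le_sq' (abs_le.1 h2).1 (abs_le.1 h2).2
            calc (ρ * a - b * c) ^ 2 = (a * (ρ - b) + b * (a - c)) ^ 2 := by ring
              _ ≤ 2 * (a ^ 2 * (ρ - b) ^ 2) + 2 * (b ^ 2 * (a - c) ^ 2) := by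
                  nlinarith [sq_nonneg (a * (ρ - b) - b * (a - c))]
              _ ≤ 2 * (M ^ 2 * (ρ - b) ^ 2) + 2 * (C ^ 2 * (a - c) ^ 2) := by gcongr
              _ = _ := by ring
    have h1 : Tendsto (fun s : ℕ × ℕ × ℕ => (s.1, s.2.2)) atTop atTop := by
      simp_rw [← prod_atTop_atTop_eq]
      exact tendsto_fst.prodMk (tendsto_snd.comp tendsto_snd)
    have h2 : Tendsto (fun s : ℕ × ℕ × ℕ => s.2.1) atTop atTop := by
      simp_rw [← prod_atTop_atTop_eq]
      exact tendsto_fst.comp tendsto_snd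
    have h3 := ((hrlim.comp h1).const_mul (2 * M ^ 2)).add ((hwlim.comp h2).const_mul (2 * C ^ 2))
    simp only [mul_zero, add_zero] at h3
    exact squeeze_zero (fun s => integral_nonneg fun D => sq_nonneg _)
      (fun s => hbound s.1 s.2.1 s.2.2) h3
  · rw [← hmv.1]
    exact integral_comp_of_measurePreserving (hval _ _ _) hgm.aestronglyMeasurable
  · rw [← hmv.2, ← (hval s.1 s.2.1 s.2.2).map_eq,
      variance_map _ (hval _ _ _).measurable.aemeasurable]
    · rfl
    · rw [(hval _ _ _).map_eq]
      exact hgm.aemeasurable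

end Moments

/-! ### Limits of the source-wise estimate -/

section Limits

lemma abs_cut_sub_le {cut : ℝ → ℝ} (hcut : cut = id ∨ cut = fun t => max t 0) (t : ℝ) {s : ℝ}
    (hs : 0 ≤ s) : |cut t - s| ≤ |t - s| := by
  rcases hcut with rfl | rfl
  · rfl
  · have h := abs_max_sub_max_le_abs t s 0
    rwa [max_eq_left hs] at h

lemma continuous_of_cut {cut : ℝ → ℝ} (hcut : cut = id ∨ cut = fun t => max t 0) :
    Continuous cut := by
  rcases hcut with rfl | rfl
  · exact continuous_id
  · exact continuous_id.max continuous_const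

/-- The limits of mean and variance of the source-wise estimate, over general feature and output
spaces and for a bounded continuous loss. -/
theorem limits_sourceEstimate {𝒳 𝒴 : Type*} [MeasureSpace 𝒳] [MeasureSpace 𝒴]
    [TopologicalSpace 𝒳] [SecondCountableTopology 𝒳] [BorelSpace 𝒳]
    [TopologicalSpace 𝒴] [TopologicalSpace.PseudoMetrizableSpace 𝒴] [SecondCountableTopology 𝒴]
    [BorelSpace 𝒴] [SFinite (volume : Measure 𝒳)] [SFinite (volume : Measure 𝒴)]
    {pT pS : 𝒳 × 𝒴 → ℝ} (hpT : IsJointDensity pT) (hpS : IsJointDensity pS)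
    (hsupp : SourceCoversTarget pT pS) (hcond : SameConditional pT pS)
    {C : ℝ} (hC : ∀ᵐ x ∂(featureLaw pS), densityRatio pT pS x ≤ C)
    {L : 𝒴 → 𝒴 → ℝ} (hL : Continuous fun p : 𝒴 × 𝒴 => L p.1 p.2)
    {M : ℝ} (hLM : ∀ u v, |L u v| ≤ M)
    {W : Type*} [MetricSpace W] [CompactSpace W] [MeasurableSpace W] [BorelSpace W]
    {Θ : Type*} (θ : Θ) (h : 𝒳 → W → Θ → 𝒴)
    (hmeas : ∀ ω, Measurable fun x => h x ω θ) (hcont : ∀ x, Continuous fun ω => h x ω θ)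
    {ωS : W} (hωS : ∀ ω, ω ≠ ωS → risk pS L h θ ωS < risk pS L h θ ω)
    {ωhat : (n : ℕ) → (Fin n → 𝒳 × 𝒴) → W} (hωhat_meas : ∀ n, Measurable (ωhat n))
    (hωhat : ∀ n D, IsMinOn (empRisk L h θ D) Set.univ (ωhat n D))
    {H : Type*} [NormedAddCommGroup H] [InnerProductSpace ℝ H] [CompleteSpace H] [RKHS ℝ H 𝒳 ℝ]
    (hker_cont : Continuous fun p : 𝒳 × 𝒳 => RKHS.kernel H p.1 p.2 (1 : ℝ))
    {B : ℝ} (hker_bdd : ∀ x : 𝒳, RKHS.kernel H x x (1 : ℝ) ≤ B)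
    (happrox : ∀ ε > 0, ∃ g : H, ∫ x, (g x - densityRatio pT pS x) ^ 2 ∂(featureLaw pS) ≤ ε)
    {reg : ℕ → ℕ → ℝ} (hreg_pos : ∀ n m, 0 < reg n m)
    (hreg_zero : Tendsto (fun s : ℕ × ℕ => reg s.1 s.2) atTop (𝓝 0))
    (hreg_slow : Tendsto (fun s : ℕ × ℕ => reg s.1 s.2 * ((min s.1 s.2 : ℕ) : ℝ)) atTop atTop)
    {what : (n m : ℕ) → (Fin n → 𝒳) → (Fin m → 𝒳) → H}
    (hwhat : ∀ n m a b, IsMinOn (ulsifObjective (H := H) (reg n m) a b) Set.univ (what n m a b))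
    {cut : ℝ → ℝ} (hcut : cut = id ∨ cut = fun t => max t 0) {nval : ℕ} (hnval : 0 < nval) :
    (∀ nde ntr nT, MemLp (sourceEstimate L h θ cut (what nde nT) (ωhat ntr)) 2
        (sampleLaw pT pS nde ntr nval nT)) ∧
    Tendsto (fun s : ℕ × ℕ × ℕ =>
        ∫ D, sourceEstimate L h θ cut (what s.1 s.2.2) (ωhat s.2.1) D
          ∂(sampleLaw pT pS s.1 s.2.1 nval s.2.2))
      atTop (𝓝 (risk pT L h θ ωS)) ∧
    Tendsto (fun s : ℕ × ℕ × ℕ =>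
        variance (sourceEstimate L h θ cut (what s.1 s.2.2) (ωhat s.2.1))
          (sampleLaw pT pS s.1 s.2.1 nval s.2.2))
      atTop
      (𝓝 ((1 / (nval : ℝ)) *
        ((∫ z, (densityRatio pT pS z.1 * L (h z.1 ωS θ) z.2) ^ 2 ∂(jointLaw pS)) -
          (risk pT L h θ ωS) ^ 2))) := by
  have hJ := hpS.isProbabilityMeasure_jointLaw
  have hP := hpS.isProbabilityMeasure_featureLaw
  have hQ := hpT.isProbabilityMeasure_featureLaw
  -- a version of the density ratio that is bounded everywhere
  let r : 𝒳 → ℝ := fun x => min (densityRatio pT pS x) (max C 0)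
  have hrm : Measurable r := (measurable_densityRatio hpT hpS).min measurable_const
  have hr0 : ∀ x, 0 ≤ r x := fun x =>
    le_min (densityRatio_nonneg hpT hpS x) (le_max_right _ _)
  have hrC : ∀ x, r x ≤ max C 0 := fun x => min_le_right _ _
  have hrP : ∀ᵐ x ∂(featureLaw pS), densityRatio pT pS x = r x := by
    filter_upwards [hC] with x hx
    exact (min_eq_left (hx.trans (le_max_left _ _))).symm
  have hrJ : ∀ᵐ z ∂(jointLaw pS), densityRatio pT pS z.1 = r z.1 :=
    ae_of_ae_map measurable_fst.aemeasurable hrP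
  have hQr : featureLaw pT = (featureLaw pS).withDensity fun x => ENNReal.ofReal (r x) := by
    rw [featureLaw_eq_withDensity hpT hpS hsupp hcond]
    exact withDensity_congr_ae (hrP.mono fun x hx => by simp only [hx])
  have hJr : jointLaw pT = (jointLaw pS).withDensity fun z => ENNReal.ofReal (r z.1) := by
    rw [jointLaw_eq_withDensity hpT hpS hsupp hcond]
    exact withDensity_congr_ae (hrJ.mono fun x hx => by simp only [hx])
  -- the loss as a function of the parameter and the observation
  let ℓ : W → 𝒳 × 𝒴 → ℝ := fun ω z => L (h z.1 ω θ) z.2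
  have hℓm : ∀ ω, Measurable (ℓ ω) := fun ω =>
    hL.measurable.comp (((hmeas ω).comp measurable_fst).prodMk measurable_snd)
  have hℓc : ∀ z, Continuous fun ω => ℓ ω z := fun z =>
    hL.comp ((hcont z.1).prodMk continuous_const)
  have hℓ : Measurable (Function.uncurry ℓ) :=
    measurable_uncurry_of_continuous_of_measurable hℓc hℓm
  have hrisk : risk pT L h θ ωS = ∫ z, r z.1 * ℓ ωS z ∂(jointLaw pS) :=
    integral_eq_integral_mul_of_withDensity (hrm.comp measurable_fst) (fun z => hr0 z.1) hJr _
  have hsq : ∫ z, (densityRatio pT pS z.1 * L (h z.1 ωS θ) z.2) ^ 2 ∂(jointLaw pS)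
      = ∫ z, (r z.1 * ℓ ωS z) ^ 2 ∂(jointLaw pS) :=
    integral_congr_ae (hrJ.mono fun z hz => by simp only [hz, ℓ])
  have hwlim := tendsto_integral_sq_loss_sub (μ := jointLaw pS) hℓm hℓc (fun ω z => hLM _ _)
    hωS hωhat_meas fun n D ω => hωhat n D (Set.mem_univ ω)
  -- the importance fit
  have hk := continuous_kerFun_one hker_cont
  have hkb := norm_kerFun_one_le hker_bdd
  have hsol := fun n m a b => normalEq_of_isMinOn (hwhat n m a b)
  have hrlim := tendsto_integral_sq_fit (P := featureLaw pS) (Q := featureLaw pT) hk hkb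
    (Real.sqrt_nonneg _) hrm hr0 hrC (le_max_right _ _) hQr (fun ε hε => by
      obtain ⟨g, hg⟩ := happrox ε hε
      refine ⟨g, le_trans (le_of_eq ?_) hg⟩
      refine integral_congr_ae (hrP.mono fun x hx => ?_)
      simp only [inner_kerFun_one, hx]) hreg_pos hreg_zero hreg_slow hsol
  simp_rw [inner_kerFun_one] at hrlim
  let rhat : (n m : ℕ) → ((Fin n → 𝒳) × (Fin m → 𝒳)) × 𝒳 → ℝ :=
    fun n m z => cut (what n m z.1.1 z.1.2 z.2)
  have hwc : ∀ n m, Continuous fun z : ((Fin n → 𝒳) × (Fin m → 𝒳)) × 𝒳 =>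
      what n m z.1.1 z.1.2 z.2 := fun n m => by
    have h1 := NormalEq.continuous hk (hreg_pos n m) (by positivity) (hsol n m)
    have h2 : Continuous fun z : ((Fin n → 𝒳) × (Fin m → 𝒳)) × 𝒳 =>
        (inner ℝ (RKHS.kerFun H z.2 (1 : ℝ)) (what n m z.1.1 z.1.2) : ℝ) :=
      (hk.comp continuous_snd).inner (h1.comp continuous_fst)
    simpa only [inner_kerFun_one] using h2
  have hwb : ∀ n m, ∃ K, ∀ z : ((Fin n → 𝒳) × (Fin m → 𝒳)) × 𝒳,
      |what n m z.1.1 z.1.2 z.2| ≤ K := fun n m => by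
    refine ⟨√B * (1 / m * m * √B / reg n m), fun z => ?_⟩
    rw [← inner_kerFun_one]
    exact (abs_inner_feature_le hkb _ _).trans (mul_le_mul_of_nonneg_left
      ((hsol n m _ _).norm_le hkb (Real.sqrt_nonneg _) (hreg_pos n m) (by positivity)
        (by positivity)) (Real.sqrt_nonneg _))
  have hrhatm : ∀ n m, Measurable (rhat n m) := fun n m =>
    ((continuous_of_cut hcut).comp (hwc n m)).measurable
  have hrhatb : ∀ n m, ∃ K, ∀ z, |rhat n m z| ≤ K := fun n m => by
    obtain ⟨K, hK⟩ := hwb n m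
    refine ⟨K, fun z => ?_⟩
    have h1 := abs_cut_sub_le hcut (what n m z.1.1 z.1.2 z.2) le_rfl
    rw [sub_zero, sub_zero] at h1
    exact h1.trans (hK z)
  have hrhatlim : Tendsto (fun s : ℕ × ℕ => ∫ z, (rhat s.1 s.2 z - r z.2) ^ 2
      ∂(((Measure.pi fun _ : Fin s.1 => featureLaw pS).prod
        (Measure.pi fun _ : Fin s.2 => featureLaw pT)).prod (featureLaw pS))) atTop (𝓝 0) := by
    refine squeeze_zero (fun s => integral_nonneg fun z => sq_nonneg _) (fun s => ?_) hrlim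
    obtain ⟨K, hK⟩ := hwb s.1 s.2
    refine integral_mono_of_nonneg (ae_of_all _ fun z => sq_nonneg _) ?_
      (ae_of_all _ fun z => sq_le_sq.2 (abs_cut_sub_le hcut _ (hr0 z.2)))
    refine Integrable.of_bound (((hwc s.1 s.2).measurable.sub
      (hrm.comp measurable_snd)).pow_const 2).aestronglyMeasurable ((K + max C 0) ^ 2)
      (ae_of_all _ fun z => ?_)
    rw [norm_pow, Real.norm_eq_abs]
    refine pow_le_pow_left₀ (abs_nonneg _) ((abs_sub _ _).trans (add_le_add (hK z) ?_)) 2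
    rw [abs_of_nonneg (hr0 _)]
    exact hrC _
  rw [hrisk, hsq]
  exact limits_of_mean_square_convergence (J := jointLaw pS) (Q := featureLaw pT) rfl hrm hr0 hrC
    hℓ (fun ω z => hLM _ _) hωhat_meas hrhatm hrhatb hrhatlim hwlim hnval
    (fun n t m => sourceEstimate L h θ cut (what n m) (ωhat t)) rfl
    (fun n t m => sampleLaw pT pS n t nval m) rfl

end Limits

end CovShift

theorem theorem1
    -- bounded feature space in `ℝ^d` and bounded output space in `ℝ`
    {d : ℕ} (X : Set (EuclideanSpace ℝ (Fin d))) (hX : MeasurableSet X)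
    (hXb : Bornology.IsBounded X)
    (Y : Set ℝ) (hY : MeasurableSet Y) (hYb : Bornology.IsBounded Y)
    -- target and source densities, covariate shift assumptions
    (pT pS : X × Y → ℝ) (hpT : CovShift.IsJointDensity pT) (hpS : CovShift.IsJointDensity pS)
    (hsupp : CovShift.SourceCoversTarget pT pS) (hcond : CovShift.SameConditional pT pS)
    (C : ℝ) (hC : ∀ᵐ x ∂(CovShift.featureLaw pS), CovShift.densityRatio pT pS x ≤ C)
    -- loss
    (L : Y → Y → ℝ) (hL0 : ∀ u v, 0 ≤ L u v)
    (hL : ∃ K, LipschitzWith K fun p : Y × Y => L p.1 p.2)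
    -- parametric model, at a fixed hyperparameter `θ`
    {W : Type*} [MetricSpace W] [CompactSpace W] [MeasurableSpace W] [BorelSpace W]
    {Θ : Type*} (θ : Θ) (h : X → W → Θ → Y)
    (hmeas : ∀ ω, Measurable fun x => h x ω θ) (hcont : ∀ x, Continuous fun ω => h x ω θ)
    -- the ideal parameter is the unique minimizer of the source risk
    (ωS : W) (hωS : ∀ ω, ω ≠ ωS → CovShift.risk pS L h θ ωS < CovShift.risk pS L h θ ω)
    -- empirical risk minimizer on the training sample
    (ωhat : (n : ℕ) → (Fin n → X × Y) → W) (hωhat_meas : ∀ n, Measurable (ωhat n))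
    (hωhat : ∀ n D, IsMinOn (CovShift.empRisk L h θ D) Set.univ (ωhat n D))
    -- reproducing kernel Hilbert space with a bounded continuous kernel, whose closure in
    -- `L²` of the source features contains the density ratio
    {H : Type*} [NormedAddCommGroup H] [InnerProductSpace ℝ H] [CompleteSpace H] [RKHS ℝ H X ℝ]
    (hker_cont : Continuous fun p : X × X => RKHS.kernel H p.1 p.2 (1 : ℝ))
    (hker_bdd : ∃ B : ℝ, ∀ x : X, RKHS.kernel H x x (1 : ℝ) ≤ B)
    (happrox : ∀ ε > 0, ∃ g : H,
      ∫ x, (g x - CovShift.densityRatio pT pS x) ^ 2 ∂(CovShift.featureLaw pS) ≤ ε)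
    -- regularization parameter, depending on the two sample sizes
    (reg : ℕ → ℕ → ℝ) (hreg_pos : ∀ n m, 0 < reg n m)
    (hreg_zero : Tendsto (fun s : ℕ × ℕ => reg s.1 s.2) atTop (𝓝 0))
    (hreg_slow : Tendsto (fun s : ℕ × ℕ => reg s.1 s.2 * ((min s.1 s.2 : ℕ) : ℝ)) atTop atTop)
    -- least-squares importance fitting on the features of `D^de` and on `D_T`
    (what : (n m : ℕ) → (Fin n → X) → (Fin m → X) → H)
    (hwhat : ∀ n m a b,
      IsMinOn (CovShift.ulsifObjective (H := H) (reg n m) a b) Set.univ (what n m a b))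
    -- the fitted ratio is used as it is, or cut off at zero
    (cut : ℝ → ℝ) (hcut : cut = id ∨ cut = fun t => max t 0)
    -- fixed validation sample size
    (nval : ℕ) (hnval : 0 < nval) :
    (∀ nde ntr nT,
      MemLp (CovShift.sourceEstimate L h θ cut (what nde nT) (ωhat ntr)) 2
        (CovShift.sampleLaw pT pS nde ntr nval nT)) ∧
    Tendsto
      (fun (nde, ntr, nT) =>
        ∫ D, CovShift.sourceEstimate L h θ cut (what nde nT) (ωhat ntr) D
          ∂(CovShift.sampleLaw pT pS nde ntr nval nT))
      atTop (𝓝 (CovShift.risk pT L h θ ωS)) ∧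
    Tendsto
      (fun (nde, ntr, nT) =>
        variance (CovShift.sourceEstimate L h θ cut (what nde nT) (ωhat ntr))
          (CovShift.sampleLaw pT pS nde ntr nval nT))
      atTop
      (𝓝 ((1 / (nval : ℝ)) *
        ((∫ z, (CovShift.densityRatio pT pS z.1 * L (h z.1 ωS θ) z.2) ^ 2
            ∂(CovShift.jointLaw pS)) -
          (CovShift.risk pT L h θ ωS) ^ 2))) := by
  have hfinX : IsFiniteMeasure (volume : Measure X) := ⟨by
    rw [Measure.Subtype.volume_univ hX.nullMeasurableSet]
    exact hXb.measure_lt_top⟩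
  have hfinY : IsFiniteMeasure (volume : Measure Y) := ⟨by
    rw [Measure.Subtype.volume_univ hY.nullMeasurableSet]
    exact hYb.measure_lt_top⟩
  have hBX : BorelSpace X := Subtype.borelSpace _
  have hBY : BorelSpace Y := Subtype.borelSpace _
  obtain ⟨K, hK⟩ := hL
  obtain ⟨B, hB⟩ := hker_bdd
  obtain ⟨M, hM⟩ : ∃ M, ∀ u v, |L u v| ≤ M := by
    have hb : Bornology.IsBounded (Set.univ : Set (Y × Y)) := by
      have h1 : Bornology.IsBounded (Set.univ : Set Y) := by
        obtain ⟨D, hD⟩ := Metric.isBounded_iff.1 hYb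
        exact Metric.isBounded_iff.2 ⟨D, fun u _ v _ => hD u.2 v.2⟩
      rw [← Set.univ_prod_univ]
      exact h1.prod h1
    obtain ⟨M, hM⟩ := (hK.isBounded_image hb).exists_norm_le
    exact ⟨M, fun u v => hM _ ⟨(u, v), Set.mem_univ _, rfl⟩⟩
  exact CovShift.limits_sourceEstimate hpT hpS hsupp hcond hC hK.continuous hM θ h hmeas hcont hωS
    hωhat_meas hωhat hker_cont hB happrox hreg_pos hreg_zero hreg_slow hwhat hcut hnval
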